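/- **Theorem B.2.** There are universal constants $C>0$, $k\in\mathbb N$ and, for every $d\ge 1$ and $\varepsilon>0$, an adaptive algorithm (which may use classical randomness) with black-box access to an unknown unitary $Z\in \mathrm U(d)$, such that the following holds. * *Space.* The quantum memory of the algorithm consists of two qudits of dimension $d$ and one qubit. The algorithm may apply $Z$ to the first qudit, apply unitary operations given by ancilla-free circuits, prepare a register in a computational basis state (discarding its content), and measure a register in the computational basis; it does not use the inverse of $Z$ or controlled applications of $Z$. * *Queries.* It applies $Z$ at most $C\,\frac d\varepsilon\,\log^2 d$ times. * *Gates.* Let each qudit be embedded in $\lceil \log_2 d\rceil$ qubits, and call elementary operations the one- and two-qubit gates and the preparations and measurements of single qubits. Call a *run* any part of the execution that lasts until the second qudit is replaced by a freshly prepared one, or until the output. Beyond the applications of $Z$, the algorithm uses in each run at most $C\log^k(2+d/\varepsilon)$ elementary operations, and in total at most $C\,d\,\log^k(2+d/\varepsilon)$. * *Output.* It outputs a finite set $\widehat\Theta\subset[0,2\pi)$ and, for every $Z\in\mathrm U(d)$, except with probability at most $d^{-100}$, $$\min_{\tau\in[0,2\pi)} d_{\mathrm H}(\Theta+\tau,\widehat\Theta)\le\varepsilon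 ,$$ where $\Theta=\{\theta\in[0,2\pi): e^{i\theta}\text{ is an eigenvalue of }Z\}$ and $d_{\mathrm H}$ is the Hausdorff distance in $\mathbb R/2\pi\mathbb Z$ (infinite between a nonempty set and the empty set). The bounds on queries, elementary operations per run, and elementary operations in total hold in the worst case over measurement outcomes and random choices. -/

import Mathlib

open scoped Kronecker

noncomputable section

namespace EigenphaseEstimation

/-! ### Eigenphases and Hausdorff distance up to a global shift -/

/-- The set of eigenphases of `Z`, as a subset of `[0, 2π)`. -/
def eigenphases {d : ℕ} (Z : Matrix (Fin d) (Fin d) ℂ) : Set ℝ :=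
  {θ | θ ∈ Set.Ico 0 (2 * Real.pi) ∧
    Module.End.HasEigenvalue (Matrix.toLin' Z) (Complex.exp (θ * Complex.I))}

/-- The image of a set of reals in the circle `ℝ / 2πℤ` (with its quotient metric),
after translation by `τ`. -/
def onCircle (τ : ℝ) (A : Set ℝ) : Set (AddCircle (2 * Real.pi)) :=
  (fun θ : ℝ => ((θ + τ : ℝ) : AddCircle (2 * Real.pi))) '' A

/-- Hausdorff distance in `ℝ / 2πℤ` up to a global shift. It is extended-valued, so that the
distance from a nonempty set to the empty set is `∞`. -/
def shiftHausdorff (A B : Set ℝ) : ENNReal :=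
  ⨅ τ ∈ Set.Ico 0 (2 * Real.pi), Metric.hausdorffEDist (onCircle τ A) (onCircle 0 B)

/-! ### Two qudits and one qubit -/

/-- Labels of the computational basis of `ℂ^d ⊗ ℂ^d ⊗ ℂ^2`. -/
abbrev Basis (d : ℕ) : Type := Fin d × Fin d × Bool

/-- The three registers: two qudits of dimension `d` and a qubit. -/
inductive Register : Type
  | first
  | second
  | qubit

/-- Labels of the computational basis of one register. -/
abbrev Level (d : ℕ) : Register → Type
  | .first => Fin d
  | .second => Fin d
  | .qubit => Bool

instance (d : ℕ) : (r : Register) → Fintype (Level d r)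
  | .first => inferInstanceAs (Fintype (Fin d))
  | .second => inferInstanceAs (Fintype (Fin d))
  | .qubit => inferInstanceAs (Fintype Bool)

instance (d : ℕ) : (r : Register) → DecidableEq (Level d r)
  | .first => inferInstanceAs (DecidableEq (Fin d))
  | .second => inferInstanceAs (DecidableEq (Fin d))
  | .qubit => inferInstanceAs (DecidableEq Bool)

/-- The content of register `r` in a computational basis state. -/
def get {d : ℕ} (r : Register) (x : Basis d) : Level d r :=
  match r with
  | .first => x.1
  | .second => x.2.1
  | .qubit => x.2.2

/-- Replace the content of register `r` in a computational basis state. -/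
def put {d : ℕ} (r : Register) (l : Level d r) (x : Basis d) : Basis d :=
  match r, l with
  | .first, l => (l, x.2.1, x.2.2)
  | .second, l => (x.1, l, x.2.2)
  | .qubit, l => (x.1, x.2.1, l)

/-- The number of qubits in which a qudit of dimension `d` is embedded: `⌈log₂ d⌉`. -/
def quditBits (d : ℕ) : ℕ := Nat.clog 2 d

/-- The number of qubits that a register occupies. -/
def registerBits (d : ℕ) : Register → ℕ
  | .first => quditBits d
  | .second => quditBits d
  | .qubit => 1

/-! ### Circuits of one- and two-qubit gates on `2 ⌈log₂ d⌉ + 1` qubits -/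

/-- The qubits carrying the first qudit, the second qudit, and the extra qubit. -/
abbrev Wire (n : ℕ) : Type := Fin n ⊕ Fin n ⊕ Unit

/-- The embedding of basis labels into bit strings, through binary expansion. -/
def encode {d : ℕ} (x : Basis d) : Wire (quditBits d) → Bool
  | .inl i => Nat.testBit x.1 i
  | .inr (.inl i) => Nat.testBit x.2.1 i
  | .inr (.inr _) => x.2.2

/-- An arbitrary unitary gate on one or on two distinct qubits. -/
inductive Gate (n : ℕ) : Type
  | one (a : Wire n) (U : Matrix.unitaryGroup Bool ℂ)
  | two (a b : Wire n) (hab : a ≠ b) (U : Matrix.unitaryGroup (Bool × Bool) ℂ)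

/-- The action of a gate on all the qubits. -/
def Gate.matrix {n : ℕ} : Gate n → Matrix (Wire n → Bool) (Wire n → Bool) ℂ
  | .one a U => Matrix.of fun x y =>
      if ∀ w, w ≠ a → x w = y w then (U : Matrix Bool Bool ℂ) (x a) (y a) else 0
  | .two a b _ U => Matrix.of fun x y =>
      if ∀ w, w ≠ a → w ≠ b → x w = y w then
        (U : Matrix (Bool × Bool) (Bool × Bool) ℂ) (x a, x b) (y a, y b) else 0

/-- The action of a circuit, whose gates are listed in order of execution. -/
def circuitMatrix {n : ℕ} : List (Gate n) → Matrix (Wire n → Bool) (Wire n → Bool) ℂ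
  | [] => 1
  | g :: c => circuitMatrix c * g.matrix

/-- A unitary operation on two qudits and a qubit, with an ancilla-free circuit which realizes it
on the embedded space. (As `op` is unitary, `spec` says that the circuit maps the embedded space
to itself, and acts there as `op`.) -/
structure GateOp (d : ℕ) : Type where
  op : Matrix.unitaryGroup (Basis d) ℂ
  circuit : List (Gate (quditBits d))
  spec : ∀ x y : Basis d,
    circuitMatrix circuit (encode x) (encode y) = (op : Matrix (Basis d) (Basis d) ℂ) x y

/-! ### Algorithms -/

/-- Adaptive algorithms with oracle access to an unknown unitary channel of dimension `d`, whose
quantum memory consists of two qudits and one qubit. The steps are: output a finite set of phases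
in `[0, 2π)`; apply the unknown unitary to the first qudit; apply a unitary operation that is given
by a circuit; discard the content of a register and prepare it in a computational basis
state; measure a register in the computational basis, and continue depending on the outcome;
draw a uniformly random element of a finite set, and continue depending on it. -/
inductive Algorithm (d : ℕ) : Type
  | output (S : Finset ℝ) (hS : (S : Set ℝ) ⊆ Set.Ico 0 (2 * Real.pi))
  | query (next : Algorithm d)
  | apply (V : GateOp d) (next : Algorithm d)
  | prepare (r : Register) (l : Level d r) (next : Algorithm d)
  | measure (r : Register) (next : Level d r → Algorithm d)
  | random (m : ℕ) (next : Fin (m + 1) → Algorithm d)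

/-- Density operators on two qudits and one qubit (unnormalized: the trace is the probability of
having reached the present point of the computation). -/
abbrev State (d : ℕ) : Type := Matrix (Basis d) (Basis d) ℂ

/-- The initial state: all the registers hold `|0⟩`. -/
def initialState (d : ℕ) : State d := Matrix.of fun x y =>
  if (x.1.val = 0 ∧ x.2.1.val = 0 ∧ x.2.2 = false) ∧
    (y.1.val = 0 ∧ y.2.1.val = 0 ∧ y.2.2 = false) then 1 else 0

/-- The unknown unitary, applied to the first qudit. -/
def onFirst {d : ℕ} (Z : Matrix (Fin d) (Fin d) ℂ) : Matrix (Basis d) (Basis d) ℂ :=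
  Z ⊗ₖ (1 : Matrix (Fin d × Bool) (Fin d × Bool) ℂ)

/-- Trace out register `r`, and prepare it in the basis state `l`. -/
def prepared {d : ℕ} (r : Register) (l : Level d r) (ρ : State d) : State d :=
  Matrix.of fun x y =>
    if get r x = l ∧ get r y = l then ∑ k : Level d r, ρ (put r k x) (put r k y) else 0

/-- The unnormalized state after a measurement of register `r` with outcome `l`. -/
def measured {d : ℕ} (r : Register) (l : Level d r) (ρ : State d) : State d :=
  Matrix.of fun x y => if get r x = l ∧ get r y = l then ρ x y else 0

open Classical in
/-- The probability that the algorithm, started in the state `ρ` with oracle `Z`, outputs a set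
with property `E`. -/
def Algorithm.probFrom {d : ℕ} (Z : Matrix (Fin d) (Fin d) ℂ) (E : Finset ℝ → Prop) :
    Algorithm d → State d → ℝ
  | .output S _, ρ => if E S then ρ.trace.re else 0
  | .query p, ρ => p.probFrom Z E (onFirst Z * ρ * (onFirst Z).conjTranspose)
  | .apply V p, ρ => p.probFrom Z E
      ((V.op : Matrix (Basis d) (Basis d) ℂ) * ρ *
        (V.op : Matrix (Basis d) (Basis d) ℂ).conjTranspose)
  | .prepare r l p, ρ => p.probFrom Z E (prepared r l ρ)
  | .measure r p, ρ => ∑ l : Level d r, (p l).probFrom Z E (measured r l ρ)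
  | .random m p, ρ => (∑ i : Fin (m + 1), (p i).probFrom Z E ρ) / (m + 1 : ℝ)

/-- The probability that the algorithm with oracle `Z` outputs a set with property `E`. -/
def Algorithm.prob {d : ℕ} (p : Algorithm d) (Z : Matrix (Fin d) (Fin d) ℂ)
    (E : Finset ℝ → Prop) : ℝ :=
  p.probFrom Z E (initialState d)

/-! ### Costs, in the worst case over outcomes and random choices -/

/-- The number of applications of the unknown unitary. -/
def Algorithm.queries {d : ℕ} : Algorithm d → ℕ
  | .output _ _ => 0
  | .query p => p.queries + 1
  | .apply _ p => p.queries
  | .prepare _ _ p => p.queries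
  | .measure r p => Finset.univ.sup fun l : Level d r => (p l).queries
  | .random _ p => Finset.univ.sup fun i => (p i).queries

/-- The total number of elementary operations beyond the applications of the unknown unitary:
one- and two-qubit gates, and preparations and measurements of single qubits. -/
def Algorithm.gates {d : ℕ} : Algorithm d → ℕ
  | .output _ _ => 0
  | .query p => p.gates
  | .apply V p => p.gates + V.circuit.length
  | .prepare r _ p => p.gates + registerBits d r
  | .measure r p => (Finset.univ.sup fun l : Level d r => (p l).gates) + registerBits d r
  | .random _ p => Finset.univ.sup fun i => (p i).gates

/-- The number of elementary operations, beyond the applications of the unknown unitary, until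
the second qudit is replaced by a fresh one (or until the output, if this does not occur). -/
def Algorithm.currentRun {d : ℕ} : Algorithm d → ℕ
  | .output _ _ => 0
  | .query p => p.currentRun
  | .apply V p => p.currentRun + V.circuit.length
  | .prepare .second _ _ => registerBits d .second
  | .prepare .first _ p => p.currentRun + registerBits d .first
  | .prepare .qubit _ p => p.currentRun + registerBits d .qubit
  | .measure r p => (Finset.univ.sup fun l : Level d r => (p l).currentRun) + registerBits d r
  | .random _ p => Finset.univ.sup fun i => (p i).currentRun

/-- The greatest number of elementary operations, beyond the applications of the unknown unitary,
in any one run; a run lasts until the second qudit is replaced by a fresh one. -/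
def Algorithm.gatesPerRun {d : ℕ} : Algorithm d → ℕ
  | .output _ _ => 0
  | .query p => p.gatesPerRun
  | .apply V p => max (Algorithm.apply V p).currentRun p.gatesPerRun
  | .prepare r l p => max (Algorithm.prepare r l p).currentRun p.gatesPerRun
  | .measure r p => max (Algorithm.measure r p).currentRun
      (Finset.univ.sup fun l : Level d r => (p l).gatesPerRun)
  | .random _ p => Finset.univ.sup fun i => (p i).gatesPerRun

end EigenphaseEstimation

end

/-!
The first qudit is made maximally mixed, which is the same as a uniformly random eigenvector of the
oracle `Z`; it serves as a reference. When the second qudit also holds an eigenvector, applying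
`Z ^ t` between two controlled swaps of the qudits applies `Z ^ t` to one eigenvector or to the
other, depending on the qubit. So a Hadamard test detects the phase of one eigenvalue relative to
the other, without controlled applications of `Z`, and without disturbing the two eigenvectors.
Repeating the tests for the powers `t = 2 ^ j`, fewer times the higher the power, determines the
relative phase up to `ε` with `O(log d / ε)` queries, except with a probability polynomially small
in `d`. This is done for `O(d log d)` fresh maximally mixed second qudits, that is, for random
eigenvectors; as in the coupon collector's problem, every eigenvalue is then likely to be met.
-/

open scoped Kronecker

noncomputable section

namespace EigenphaseEstimation

/-! ### Diagonalization of normal and unitary matrices -/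

section NormalOperator

variable {E : Type*} [NormedAddCommGroup E] [InnerProductSpace ℂ E] [CompleteSpace E]
  {T : E →L[ℂ] E}

theorem adjoint_apply_of_mem_eigenspace (hT : IsStarNormal T) {μ : ℂ} {x : E}
    (hx : x ∈ Module.End.eigenspace (T : Module.End ℂ E) μ) :
    T.adjoint x = star μ • x := by
  have hcomm (ν : ℂ) (S : E →L[ℂ] E) : Commute S (algebraMap ℂ (E →L[ℂ] E) ν) :=
    Algebra.commute_algebraMap_right ν S
  have hnormal : IsStarNormal (T - algebraMap ℂ (E →L[ℂ] E) μ) := by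
    refine ⟨?_⟩
    rw [star_sub, ← algebraMap_star_comm]
    exact (hT.star_comm_self.sub_right (hcomm _ _)).sub_left (hcomm _ _).symm
  have hkernel : (T - algebraMap ℂ (E →L[ℂ] E) μ) x = 0 := by
    simpa [sub_eq_zero, Algebra.algebraMap_eq_smul_one] using Module.End.mem_eigenspace_iff.mp hx
  rw [← ContinuousLinearMap.IsStarNormal.adjoint_apply_eq_zero_iff hnormal] at hkernel
  simpa [Algebra.algebraMap_eq_smul_one, ← ContinuousLinearMap.star_eq_adjoint, sub_eq_zero]
    using hkernel

theorem orthogonalFamily_eigenspace_of_isStarNormal (hT : IsStarNormal T) :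
    OrthogonalFamily ℂ (fun μ : ℂ => Module.End.eigenspace (T : Module.End ℂ E) μ)
      fun μ => (Module.End.eigenspace (T : Module.End ℂ E) μ).subtypeₗᵢ := by
  rintro μ ν hne ⟨x, hx⟩ ⟨y, hy⟩
  have hTy : T y = ν • y := Module.End.mem_eigenspace_iff.mp hy
  have h := T.adjoint_inner_left y x
  rw [adjoint_apply_of_mem_eigenspace hT hx, hTy, inner_smul_left, inner_smul_right,
    RCLike.star_def, Complex.conj_conj] at h
  exact (mul_eq_mul_right_iff.mp h).resolve_left hne

variable [FiniteDimensional ℂ E]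

theorem iSup_eigenspace_eq_top_of_isStarNormal (hT : IsStarNormal T) :
    ⨆ μ, Module.End.eigenspace (T : Module.End ℂ E) μ = ⊤ := by
  set S := ⨆ μ, Module.End.eigenspace (T : Module.End ℂ E) μ
  have hadjoint : ∀ x ∈ S, T.adjoint x ∈ S := fun x hx => by
    refine Submodule.iSup_induction _ (motive := fun x => T.adjoint x ∈ S) hx
      (fun μ y hy => ?_) (by simp) fun y z hy hz => by simpa using S.add_mem hy hz
    rw [adjoint_apply_of_mem_eigenspace hT hy]
    exact S.smul_mem _ (Submodule.mem_iSup_of_mem μ hy)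
  have hinvariant : ∀ x ∈ Sᗮ, (T : Module.End ℂ E) x ∈ Sᗮ := fun x hx y hy => by
    rw [ContinuousLinearMap.coe_coe, ← ContinuousLinearMap.adjoint_inner_left]
    exact hx _ (hadjoint y hy)
  rw [← Submodule.orthogonal_eq_bot_iff]
  by_contra hne
  have : Nontrivial Sᗮ := Submodule.nontrivial_iff_ne_bot.mpr hne
  obtain ⟨μ, hμ⟩ := Module.End.exists_eigenvalue ((T : Module.End ℂ E).restrict hinvariant)
  obtain ⟨⟨x, hxS⟩, hx⟩ := hμ.exists_hasEigenvector
  have hTx : (T : Module.End ℂ E) x = μ • x := congrArg Subtype.val hx.apply_eq_smul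
  exact hx.2 (Subtype.ext (inner_self_eq_zero.mp
    (hxS x (Submodule.mem_iSup_of_mem μ (Module.End.mem_eigenspace_iff.mpr hTx)))))

theorem exists_orthonormalBasis_of_isStarNormal (hT : IsStarNormal T) {ι : Type*} [Fintype ι]
    (hι : Module.finrank ℂ E = Fintype.card ι) :
    ∃ (b : OrthonormalBasis ι ℂ E) (μ : ι → ℂ), ∀ i, T (b i) = μ i • b i := by
  have horth : OrthogonalFamily ℂ
      (fun μ : Module.End.Eigenvalues (T : Module.End ℂ E) =>
        Module.End.eigenspace (T : Module.End ℂ E) (μ : ℂ)) fun μ =>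
      (Module.End.eigenspace (T : Module.End ℂ E) (μ : ℂ)).subtypeₗᵢ :=
    (orthogonalFamily_eigenspace_of_isStarNormal hT).comp Subtype.val_injective
  have hint : DirectSum.IsInternal fun μ : Module.End.Eigenvalues (T : Module.End ℂ E) =>
      Module.End.eigenspace (T : Module.End ℂ E) (μ : ℂ) := by
    rw [horth.isInternal_iff, Submodule.orthogonal_eq_bot_iff,
      ← iSup_eigenspace_eq_top_of_isStarNormal hT]
    exact iSup_ne_bot_subtype fun μ => Module.End.eigenspace (T : Module.End ℂ E) μ
  let e := (Fintype.equivFin ι).symm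
  refine ⟨(hint.subordinateOrthonormalBasis hι horth).reindex e,
    fun i => (hint.subordinateOrthonormalBasisIndex hι (e.symm i) horth).1, fun i => ?_⟩
  rw [OrthonormalBasis.reindex_apply]
  exact Module.End.mem_eigenspace_iff.mp
    (hint.subordinateOrthonormalBasis_subordinate hι (e.symm i) horth)

end NormalOperator

theorem exists_unitary_eq_mul_diagonal_mul_star {n : Type*} [Fintype n] [DecidableEq n]
    {A : Matrix n n ℂ} (hA : IsStarNormal A) :
    ∃ (V : Matrix.unitaryGroup n ℂ) (μ : n → ℂ),
      A = V * Matrix.diagonal μ * star (V : Matrix n n ℂ) := by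
  have hT : IsStarNormal (Matrix.toEuclideanCLM (𝕜 := ℂ) A) := IsStarNormal.map _ _
  obtain ⟨b, μ, hb⟩ := exists_orthonormalBasis_of_isStarNormal hT finrank_euclideanSpace
  let V : Matrix.unitaryGroup n ℂ := ⟨(EuclideanSpace.basisFun n ℂ).toBasis.toMatrix b.toBasis,
    (EuclideanSpace.basisFun n ℂ).toMatrix_orthonormalBasis_mem_unitary b⟩
  have hAV : A * V = V * Matrix.diagonal μ := by
    ext i j
    have hentry := congrFun (congrArg WithLp.ofLp (hb j)) i
    rw [Matrix.mul_diagonal, mul_comm]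
    simpa [Matrix.ofLp_toEuclideanCLM] using! hentry
  refine ⟨V, μ, ?_⟩
  rw [← hAV, mul_assoc, Unitary.mul_star_self_of_mem V.2, mul_one]

theorem exp_ofReal_mul_I_injOn :
    Set.InjOn (fun x : ℝ => Complex.exp (x * Complex.I)) (Set.Ico 0 (2 * Real.pi)) := by
  intro x hx y hy h
  obtain ⟨n, hn⟩ := Complex.exp_eq_exp_iff_exists_int.mp h
  have hxy : x = y + n • (2 * Real.pi) := by simpa using congrArg Complex.im hn
  have hmod := toIcoMod_add_zsmul Real.two_pi_pos 0 y n
  rw [← hxy] at hmod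
  rw [← zero_add (2 * Real.pi)] at hx hy
  rwa [(toIcoMod_eq_self Real.two_pi_pos).mpr hx, (toIcoMod_eq_self Real.two_pi_pos).mpr hy] at hmod

theorem exists_mem_Ico_exp_mul_I_eq {z : ℂ} (hz : ‖z‖ = 1) :
    ∃ θ ∈ Set.Ico 0 (2 * Real.pi), Complex.exp ((θ : ℝ) * Complex.I) = z := by
  refine ⟨toIcoMod Real.two_pi_pos 0 z.arg,
    by simpa using toIcoMod_mem_Ico Real.two_pi_pos 0 z.arg, ?_⟩
  have harg : Complex.exp (z.arg * Complex.I) = z := by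
    simpa [hz] using Complex.norm_mul_exp_arg_mul_I z
  conv_rhs => rw [← harg]
  rw [Complex.exp_eq_exp_iff_exists_int]
  refine ⟨-toIcoDiv Real.two_pi_pos 0 z.arg, ?_⟩
  rw [toIcoMod]
  push_cast [zsmul_eq_mul]
  ring

/-- A diagonalization of `Z` by the unitary `V`, whose columns are eigenvectors of `Z` with
eigenphases `θ`. -/
structure IsEigenframe {d : ℕ} (Z : Matrix (Fin d) (Fin d) ℂ) (V : Matrix.unitaryGroup (Fin d) ℂ)
    (θ : Fin d → ℝ) : Prop where
  mem_Ico : ∀ a, θ a ∈ Set.Ico 0 (2 * Real.pi)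
  eq_conj : Z = V * Matrix.diagonal (fun a => Complex.exp (θ a * Complex.I)) *
    star (V : Matrix (Fin d) (Fin d) ℂ)

theorem exists_isEigenframe {d : ℕ} {Z : Matrix (Fin d) (Fin d) ℂ}
    (hZ : Z ∈ Matrix.unitaryGroup (Fin d) ℂ) : ∃ V θ, IsEigenframe Z V θ := by
  have hnormal : IsStarNormal Z :=
    ⟨(Matrix.mem_unitaryGroup_iff'.mp hZ).trans (Matrix.mem_unitaryGroup_iff.mp hZ).symm⟩
  obtain ⟨V, μ, hV⟩ := exists_unitary_eq_mul_diagonal_mul_star hnormal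
  have hD : Matrix.diagonal μ ∈ Matrix.unitaryGroup (Fin d) ℂ := by
    have h : Matrix.diagonal μ = star (V : Matrix (Fin d) (Fin d) ℂ) * Z * V := by
      rw [hV, ← mul_assoc, ← mul_assoc, Unitary.coe_star_mul_self, one_mul, mul_assoc,
        Unitary.coe_star_mul_self, mul_one]
    rw [h]
    exact mul_mem (mul_mem (Unitary.star_mem V.2) hZ) V.2
  have hμ (a : Fin d) : ‖μ a‖ = 1 := by
    have h := congrFun₂ (Matrix.mem_unitaryGroup_iff.mp hD) a a
    simp only [Matrix.star_eq_conjTranspose, Matrix.diagonal_conjTranspose,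
      Matrix.diagonal_mul_diagonal, Matrix.diagonal_apply_eq, Matrix.one_apply_eq, Pi.star_apply,
      RCLike.star_def, Complex.mul_conj'] at h
    exact (pow_eq_one_iff_of_nonneg (norm_nonneg _) two_ne_zero).mp (mod_cast h)
  choose θ hθ hexp using fun a => exists_mem_Ico_exp_mul_I_eq (hμ a)
  exact ⟨V, θ, hθ, by simpa only [hexp] using hV⟩

theorem IsEigenframe.eigenphases_eq_range {d : ℕ} {Z : Matrix (Fin d) (Fin d) ℂ}
    {V : Matrix.unitaryGroup (Fin d) ℂ} {θ : Fin d → ℝ} (h : IsEigenframe Z V θ) :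
    eigenphases Z = Set.range θ := by
  have hspec : spectrum ℂ (Matrix.toLin' Z) = Set.range fun a => Complex.exp (θ a * Complex.I) := by
    rw [Matrix.spectrum_toLin', h.eq_conj, Unitary.spectrum_star_right_conjugate,
      spectrum_diagonal]
  ext φ
  rw [eigenphases, Set.mem_ofPred_eq, Module.End.hasEigenvalue_iff_mem_spectrum, hspec]
  constructor
  · rintro ⟨hφ, a, ha⟩
    exact ⟨a, exp_ofReal_mul_I_injOn (h.mem_Ico a) hφ ha⟩
  · rintro ⟨a, rfl⟩
    exact ⟨h.mem_Ico a, a, rfl⟩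

theorem IsEigenframe.mulVec_col {d : ℕ} {Z : Matrix (Fin d) (Fin d) ℂ}
    {V : Matrix.unitaryGroup (Fin d) ℂ} {θ : Fin d → ℝ} (h : IsEigenframe Z V θ) (a : Fin d) :
    Z.mulVec ((V : Matrix (Fin d) (Fin d) ℂ).col a) =
      Complex.exp (θ a * Complex.I) • (V : Matrix (Fin d) (Fin d) ℂ).col a := by
  have hZV : Z * V = V * Matrix.diagonal fun a => Complex.exp (θ a * Complex.I) := by
    rw [h.eq_conj, mul_assoc _ (star (V : Matrix (Fin d) (Fin d) ℂ)), Unitary.coe_star_mul_self,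
      mul_one]
  ext i
  have hentry := congrFun₂ hZV i a
  rw [Matrix.mul_diagonal, mul_comm] at hentry
  exact hentry

/-! ### Circuits -/

theorem kronecker_mulVec_apply {l m n p R : Type*} [Fintype m] [Fintype p] [CommSemiring R]
    (A : Matrix l m R) (B : Matrix n p R) (ψ : m × p → R) (x : l × n) :
    (A ⊗ₖ B).mulVec ψ x = ∑ i, A x.1 i * ∑ j, B x.2 j * ψ (i, j) := by
  simp only [Matrix.mulVec, dotProduct, Matrix.kroneckerMap_apply, Fintype.sum_prod_type,
    Finset.mul_sum, mul_assoc]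

/-- The unitary that permutes the computational basis by `σ`. -/
def permUnitary {n : Type*} [Fintype n] [DecidableEq n] (σ : Equiv.Perm n) :
    Matrix.unitaryGroup n ℂ :=
  ⟨σ.permMatrix ℂ, by
    rw [Matrix.mem_unitaryGroup_iff, Matrix.star_eq_conjTranspose, Matrix.conjTranspose_permMatrix,
      ← Matrix.permMatrix_mul, inv_mul_cancel, Matrix.permMatrix_one]⟩

/-- The `4 × 4` matrix that applies `U` to the first qubit if the second one is set. -/
def controlled (U : Matrix.unitaryGroup Bool ℂ) : Matrix.unitaryGroup (Bool × Bool) ℂ :=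
  ⟨Matrix.blockDiagonal fun b => if b then (U : Matrix Bool Bool ℂ) else 1, by
    rw [Matrix.mem_unitaryGroup_iff, Matrix.star_eq_conjTranspose,
      Matrix.blockDiagonal_conjTranspose, ← Matrix.blockDiagonal_mul, ← Matrix.blockDiagonal_one]
    congr 1
    ext1 b
    cases b
    · simp
    · exact Matrix.mem_unitaryGroup_iff.mp U.2⟩

/-- A square root of the negation of a bit. -/
def sqrtNot : Matrix.unitaryGroup Bool ℂ :=
  ⟨Matrix.of fun p q => if p = q then (1 + Complex.I) / 2 else (1 - Complex.I) / 2, by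
    rw [Matrix.mem_unitaryGroup_iff]
    ext p q
    cases p <;> cases q <;> simp [Matrix.mul_apply, Matrix.star_apply] <;> ring_nf <;>
      norm_num [map_ofNat]⟩

section Gate

variable {n : ℕ}

theorem Gate.one_mulVec (a : Wire n) (U : Matrix.unitaryGroup Bool ℂ)
    (ψ : (Wire n → Bool) → ℂ) (x : Wire n → Bool) :
    (Gate.one a U).matrix.mulVec ψ x =
      ∑ p, (U : Matrix Bool Bool ℂ) (x a) p * ψ (Function.update x a p) := by
  symm
  apply Fintype.sum_of_injective (fun p => Function.update x a p) (Function.update_injective x a)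
  · intro y hy
    have hfar : ¬∀ w, w ≠ a → x w = y w := fun h =>
      hy ⟨y a, Function.update_eq_iff.mpr ⟨rfl, h⟩⟩
    simp only [Gate.matrix, Matrix.of_apply, if_neg hfar, zero_mul]
  · intro p
    simp +contextual [Gate.matrix]

theorem Gate.two_mulVec {a b : Wire n} (hab : a ≠ b) (U : Matrix.unitaryGroup (Bool × Bool) ℂ)
    (ψ : (Wire n → Bool) → ℂ) (x : Wire n → Bool) :
    (Gate.two a b hab U).matrix.mulVec ψ x =
      ∑ p : Bool × Bool, (U : Matrix (Bool × Bool) (Bool × Bool) ℂ) (x a, x b) p *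
        ψ (Function.update (Function.update x a p.1) b p.2) := by
  symm
  apply Fintype.sum_of_injective
    (fun p : Bool × Bool => Function.update (Function.update x a p.1) b p.2)
  · rintro ⟨p, q⟩ ⟨p', q'⟩ h
    simpa [hab] using And.intro (congrFun h a) (congrFun h b)
  · intro y hy
    have hfar : ¬∀ w, w ≠ a → w ≠ b → x w = y w := by
      refine fun h => hy ⟨(y a, y b), Function.update_eq_iff.mpr ⟨rfl, fun w hwb => ?_⟩⟩
      by_cases hwa : w = a
      · rw [hwa, Function.update_self]
      · rw [Function.update_of_ne hwa, h w hwa hwb]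
    simp only [Gate.matrix, Matrix.of_apply, if_neg hfar, zero_mul]
  · intro p
    simp +contextual [Gate.matrix, hab]

theorem circuitMatrix_cons_mulVec (g : Gate n) (c : List (Gate n)) (ψ : (Wire n → Bool) → ℂ) :
    (circuitMatrix (g :: c)).mulVec ψ = (circuitMatrix c).mulVec (g.matrix.mulVec ψ) :=
  (Matrix.mulVec_mulVec ..).symm

theorem circuitMatrix_append (c e : List (Gate n)) :
    circuitMatrix (c ++ e) = circuitMatrix e * circuitMatrix c := by
  induction c with
  | nil => exact (mul_one _).symm
  | cons g c ih => rw [List.cons_append, circuitMatrix, ih, circuitMatrix, mul_assoc]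

theorem circuitMatrix_append_mulVec (c e : List (Gate n)) (ψ : (Wire n → Bool) → ℂ) :
    (circuitMatrix (c ++ e)).mulVec ψ = (circuitMatrix e).mulVec ((circuitMatrix c).mulVec ψ) := by
  rw [circuitMatrix_append, Matrix.mulVec_mulVec]

/-- The gate that applies `U` to the wire `a` if the wire `b` is set. -/
def controlledGate {a b : Wire n} (hab : a ≠ b) (U : Matrix.unitaryGroup Bool ℂ) : Gate n :=
  .two a b hab (controlled U)

theorem controlledGate_mulVec {a b : Wire n} (hab : a ≠ b) (U : Matrix.unitaryGroup Bool ℂ)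
    (ψ : (Wire n → Bool) → ℂ) (x : Wire n → Bool) :
    (controlledGate hab U).matrix.mulVec ψ x =
      if x b then ∑ p, (U : Matrix Bool Bool ℂ) (x a) p * ψ (Function.update x a p) else ψ x := by
  have hb (p q : Bool) (h : x b = q) :
      Function.update (Function.update x a p) b q = Function.update x a p := by
    rw [← h, Function.update_eq_self_iff, Function.update_of_ne hab.symm]
  rw [controlledGate, Gate.two_mulVec]
  cases h : x b <;>
    simp [controlled, Fintype.sum_prod_type, Matrix.blockDiagonal_apply, hb _ _ h,
      Matrix.one_apply]

/-- The gate that negates the wire `a` if the wire `b` is set. -/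
def cnotGate {a b : Wire n} (hab : a ≠ b) : Gate n :=
  controlledGate hab (permUnitary Equiv.boolNot)

theorem cnotGate_mulVec {a b : Wire n} (hab : a ≠ b) (ψ : (Wire n → Bool) → ℂ)
    (x : Wire n → Bool) :
    (cnotGate hab).matrix.mulVec ψ x = ψ (Function.update x a (xor (x a) (x b))) := by
  rw [cnotGate, controlledGate_mulVec]
  cases h : x b
  · simp
  · simpa [permUnitary, Matrix.mulVec, dotProduct] using
      congrFun (Matrix.permMatrix_mulVec (σ := Equiv.boolNot)
        (v := fun p => ψ (Function.update x a p))) (x a)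

theorem exists_three_wire_chart {a b c : Wire n} (hab : a ≠ b) (hac : a ≠ c) (hbc : b ≠ c)
    (x : Wire n → Bool) :
    ∃ e : Bool → Bool → Bool → Wire n → Bool, (∀ p q r, e p q r a = p) ∧
      (∀ p q r, e p q r b = q) ∧ (∀ p q r, e p q r c = r) ∧
      (∀ p q r s, Function.update (e p q r) a s = e s q r) ∧
      (∀ p q r s, Function.update (e p q r) b s = e p s r) ∧ e (x a) (x b) (x c) = x := by
  refine ⟨fun p q r => Function.update (Function.update (Function.update x a p) b q) c r,
    by simp [hab, hac], by simp [hbc], by simp, fun p q r s => ?_, fun p q r s => ?_, by simp⟩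
  · rw [Function.update_comm hac.symm, Function.update_comm hab.symm, Function.update_idem]
  · rw [Function.update_comm hbc.symm, Function.update_idem]

/-- A circuit that negates the wire `b` if the wires `a` and `c` are set: if `a` and `c` hold `p`
and `r`, it applies `sqrtNot ^ (p + r - (p ⊕ r)) = sqrtNot ^ (2 * p * r)` to `b`. -/
def toffoli {a b c : Wire n} (hab : a ≠ b) (hac : a ≠ c) (hbc : b ≠ c) : List (Gate n) :=
  [controlledGate hab.symm sqrtNot, cnotGate hac, controlledGate hab.symm (star sqrtNot),
    cnotGate hac, controlledGate hbc sqrtNot]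

theorem toffoli_mulVec {a b c : Wire n} (hab : a ≠ b) (hac : a ≠ c) (hbc : b ≠ c)
    (ψ : (Wire n → Bool) → ℂ) (x : Wire n → Bool) :
    (circuitMatrix (toffoli hab hac hbc)).mulVec ψ x =
      ψ (Function.update x b (xor (x b) (x a && x c))) := by
  obtain ⟨e, ha, hb, hc, hua, hub, hx⟩ := exists_three_wire_chart hab hac hbc x
  rw [← hx]
  simp only [toffoli, circuitMatrix_cons_mulVec]
  simp only [circuitMatrix, Matrix.one_mulVec, cnotGate_mulVec, controlledGate_mulVec,
    Fintype.sum_bool, ha, hb, hc, hua, hub]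
  generalize x a = p
  generalize x b = q
  generalize x c = r
  cases p <;> cases q <;> cases r <;>
    simp [sqrtNot, Matrix.star_apply] <;> ring_nf <;> simp <;> ring

/-- A circuit that swaps the wires `a` and `b` if the wire `c` is set. -/
def fredkin {a b c : Wire n} (hab : a ≠ b) (hac : a ≠ c) (hbc : b ≠ c) : List (Gate n) :=
  [cnotGate hab] ++ toffoli hab hac hbc ++ [cnotGate hab]

theorem fredkin_mulVec {a b c : Wire n} (hab : a ≠ b) (hac : a ≠ c) (hbc : b ≠ c)
    (ψ : (Wire n → Bool) → ℂ) (x : Wire n → Bool) :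
    (circuitMatrix (fredkin hab hac hbc)).mulVec ψ x =
      ψ (if x c then x ∘ Equiv.swap a b else x) := by
  have hcnot (φ : (Wire n → Bool) → ℂ) :
      (circuitMatrix [cnotGate hab]).mulVec φ = (cnotGate hab).matrix.mulVec φ := by
    rw [circuitMatrix, circuitMatrix, one_mul]
  rw [fredkin, circuitMatrix_append_mulVec, circuitMatrix_append_mulVec, hcnot, hcnot,
    cnotGate_mulVec, toffoli_mulVec, cnotGate_mulVec]
  congr 1
  ext w
  rcases eq_or_ne w a with rfl | hwa
  · cases h : x c <;> cases h₁ : x w <;> cases h₂ : x b <;>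
      simp [h, h₁, h₂, hab, hab.symm, hac.symm]
  rcases eq_or_ne w b with rfl | hwb
  · cases h : x c <;> cases h₁ : x a <;> simp [h, h₁, hab, hab.symm, hac.symm]
  · cases h : x c <;> simp [hwa, hwb, Equiv.swap_apply_of_ne_of_ne hwa hwb]

/-- A circuit that swaps the `i`-th wires of the two qudits, for all `i ∈ l`, if the qubit is
set. -/
def cswapCircuit (l : List (Fin n)) : List (Gate n) :=
  l.flatMap fun i => fredkin (a := .inl i) (b := .inr (.inl i)) (c := .inr (.inr ()))
    (by simp) (by simp) (by simp)

theorem length_cswapCircuit (l : List (Fin n)) : (cswapCircuit l).length = 7 * l.length := by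
  simp [cswapCircuit, List.length_flatMap, fredkin, toffoli, mul_comm]

/-- The action of `cswapCircuit l` on bit strings. -/
def cswapBits (l : List (Fin n)) (x : Wire n → Bool) : Wire n → Bool
  | .inl i => if x (.inr (.inr ())) ∧ i ∈ l then x (.inr (.inl i)) else x (.inl i)
  | .inr (.inl i) => if x (.inr (.inr ())) ∧ i ∈ l then x (.inl i) else x (.inr (.inl i))
  | .inr (.inr _) => x (.inr (.inr ()))

theorem cswapBits_nil (x : Wire n → Bool) : cswapBits [] x = x := by
  ext (_ | _ | _) <;> simp [cswapBits]

theorem cswapBits_cons {i : Fin n} {l : List (Fin n)} (hi : i ∉ l) (x : Wire n → Bool) :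
    cswapBits (i :: l) x = if x (.inr (.inr ())) then
      cswapBits l x ∘ Equiv.swap (.inl i) (.inr (.inl i)) else x := by
  cases hc : x (.inr (.inr ()))
  · ext (j | j | j) <;> simp [cswapBits, hc]
  ext (j | j | j)
  · rcases eq_or_ne j i with rfl | hj
    · simp [cswapBits, hc, hi]
    · simp [cswapBits, hc, hj, Equiv.swap_apply_of_ne_of_ne]
  · rcases eq_or_ne j i with rfl | hj
    · simp [cswapBits, hc, hi]
    · simp [cswapBits, hc, hj, Equiv.swap_apply_of_ne_of_ne]
  · simp [cswapBits, hc, Equiv.swap_apply_of_ne_of_ne]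

theorem cswapCircuit_mulVec {l : List (Fin n)} (hl : l.Nodup) (ψ : (Wire n → Bool) → ℂ)
    (x : Wire n → Bool) :
    (circuitMatrix (cswapCircuit l)).mulVec ψ x = ψ (cswapBits l x) := by
  induction l generalizing ψ with
  | nil => rw [cswapCircuit, List.flatMap_nil, circuitMatrix, Matrix.one_mulVec, cswapBits_nil]
  | cons i l ih =>
    rw [List.nodup_cons] at hl
    rw [cswapCircuit, List.flatMap_cons, circuitMatrix_append_mulVec, ← cswapCircuit, ih hl.2,
      fredkin_mulVec, cswapBits_cons hl.1]
    congr 1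
    cases hc : x (.inr (.inr ()))
    · ext (j | j | j) <;> simp [cswapBits, hc]
    · simp [cswapBits, hc]

end Gate

variable {d : ℕ}

theorem eq_of_forall_testBit_eq {i j : Fin d}
    (h : ∀ k : Fin (quditBits d), Nat.testBit i k = Nat.testBit j k) : i = j := by
  refine Fin.ext (Nat.eq_of_testBit_eq fun k => ?_)
  rcases lt_or_ge k (quditBits d) with hk | hk
  · exact h ⟨k, hk⟩
  · have hd : d ≤ 2 ^ k :=
      (Nat.le_pow_clog one_lt_two d).trans (Nat.pow_le_pow_right two_pos hk)
    rw [Nat.testBit_lt_two_pow (i.2.trans_le hd), Nat.testBit_lt_two_pow (j.2.trans_le hd)]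

theorem encode_injective : Function.Injective (encode (d := d)) := fun _ _ h =>
  Prod.ext (eq_of_forall_testBit_eq fun k => congrFun h (.inl k))
    (Prod.ext (eq_of_forall_testBit_eq fun k => congrFun h (.inr (.inl k)))
      (congrFun h (.inr (.inr ()))))

/-- The controlled exchange of the two qudits on labels of basis states. -/
def cswapLabel (x : Basis d) : Basis d := if x.2.2 then (x.2.1, x.1, x.2.2) else x

theorem cswapLabel_involutive : Function.Involutive (cswapLabel (d := d)) := by
  rintro ⟨i, j, b⟩
  cases b <;> rfl

theorem cswapBits_encode (x : Basis d) :
    cswapBits (List.finRange (quditBits d)) (encode x) = encode (cswapLabel x) := by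
  obtain ⟨i, j, b⟩ := x
  cases b <;> ext (k | k | k) <;> simp [cswapBits, encode, cswapLabel]

/-- The exchange of the two qudits if the qubit is set. -/
def cswapOp (d : ℕ) : GateOp d where
  op := permUnitary cswapLabel_involutive.toPerm
  circuit := cswapCircuit (List.finRange (quditBits d))
  spec x y := by
    have h := cswapCircuit_mulVec (List.nodup_finRange (quditBits d)) (Pi.single (encode y) 1)
      (encode x)
    rw [Matrix.mulVec_single_one, cswapBits_encode, Pi.single_apply] at h
    simp only [encode_injective.eq_iff] at h
    exact h.trans (by simp [permUnitary, PEquiv.toMatrix_apply, eq_comm])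

theorem cswapOp_mulVec (ψ : Basis d → ℂ) (x : Basis d) :
    ((cswapOp d).op : Matrix (Basis d) (Basis d) ℂ).mulVec ψ x = ψ (cswapLabel x) :=
  congrFun (Matrix.permMatrix_mulVec _) x

/-- A unitary operation on the qubit. -/
def qubitOp (d : ℕ) (U : Matrix.unitaryGroup Bool ℂ) : GateOp d where
  op := ⟨(1 : Matrix (Fin d) (Fin d) ℂ) ⊗ₖ ((1 : Matrix (Fin d) (Fin d) ℂ) ⊗ₖ
      (U : Matrix Bool Bool ℂ)),
    Matrix.kronecker_mem_unitary (one_mem _) (Matrix.kronecker_mem_unitary (one_mem _) U.2)⟩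
  circuit := [.one (.inr (.inr ())) U]
  spec x y := by
    have hqudits : (∀ w : Wire (quditBits d), w ≠ .inr (.inr ()) → encode x w = encode y w) ↔
        x.1 = y.1 ∧ x.2.1 = y.2.1 := by
      constructor
      · exact fun h => ⟨eq_of_forall_testBit_eq fun k => h (.inl k) (by simp),
          eq_of_forall_testBit_eq fun k => h (.inr (.inl k)) (by simp)⟩
      · rintro ⟨h₁, h₂⟩ (k | k | k) hk
        · simp only [encode, h₁]
        · simp only [encode, h₂]
        · exact absurd rfl hk
    simp only [circuitMatrix, Matrix.one_mul, Gate.matrix, Matrix.of_apply, hqudits]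
    by_cases h₁ : x.1 = y.1 <;> by_cases h₂ : x.2.1 = y.2.1 <;>
      simp [encode, h₁, h₂, Matrix.one_apply]

theorem qubitOp_mulVec (U : Matrix.unitaryGroup Bool ℂ) (ψ : Basis d → ℂ) (x : Basis d) :
    ((qubitOp d U).op : Matrix (Basis d) (Basis d) ℂ).mulVec ψ x =
      ∑ b, (U : Matrix Bool Bool ℂ) x.2.2 b * ψ (x.1, x.2.1, b) := by
  simp only [qubitOp, kronecker_mulVec_apply, Matrix.kroneckerMap_apply, Matrix.one_apply,
    Fintype.sum_prod_type, ite_mul, one_mul, zero_mul, Finset.sum_ite_irrel, Finset.sum_const_zero,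
    Finset.sum_ite_eq, Finset.mem_univ, if_true]

/-! ### Linearity of output probabilities -/

theorem measured_add (r : Register) (l : Level d r) (ρ σ : State d) :
    measured r l (ρ + σ) = measured r l ρ + measured r l σ := by
  ext x y
  simp only [measured, Matrix.of_apply, Matrix.add_apply]
  split_ifs <;> simp

theorem measured_smul (r : Register) (l : Level d r) (c : ℝ) (ρ : State d) :
    measured r l (c • ρ) = c • measured r l ρ := by
  ext x y
  simp only [measured, Matrix.of_apply, Matrix.smul_apply]
  split_ifs <;> simp

theorem prepared_add (r : Register) (l : Level d r) (ρ σ : State d) :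
    prepared r l (ρ + σ) = prepared r l ρ + prepared r l σ := by
  ext x y
  simp only [prepared, Matrix.of_apply, Matrix.add_apply]
  split_ifs <;> simp [Finset.sum_add_distrib]

theorem prepared_smul (r : Register) (l : Level d r) (c : ℝ) (ρ : State d) :
    prepared r l (c • ρ) = c • prepared r l ρ := by
  ext x y
  simp only [prepared, Matrix.of_apply, Matrix.smul_apply]
  split_ifs <;> simp [Finset.mul_sum]

namespace Algorithm

variable (Z : Matrix (Fin d) (Fin d) ℂ) (E : Finset ℝ → Prop)

theorem probFrom_add (p : Algorithm d) (ρ σ : State d) :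
    p.probFrom Z E (ρ + σ) = p.probFrom Z E ρ + p.probFrom Z E σ := by
  induction p generalizing ρ σ with
  | output S hS => simp only [probFrom]; split_ifs <;> simp
  | query p ih => simp only [probFrom, Matrix.mul_add, Matrix.add_mul, ih]
  | apply V p ih => simp only [probFrom, Matrix.mul_add, Matrix.add_mul, ih]
  | prepare r l p ih => simp only [probFrom, prepared_add, ih]
  | measure r p ih => simp only [probFrom, measured_add, ih, Finset.sum_add_distrib]
  | random m p ih => simp only [probFrom, ih, Finset.sum_add_distrib, add_div]

theorem probFrom_smul (p : Algorithm d) (c : ℝ) (ρ : State d) :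
    p.probFrom Z E (c • ρ) = c * p.probFrom Z E ρ := by
  induction p generalizing ρ with
  | output S hS => simp only [probFrom]; split_ifs <;> simp
  | query p ih => simp only [probFrom, Matrix.mul_smul, Matrix.smul_mul, ih]
  | apply V p ih => simp only [probFrom, Matrix.mul_smul, Matrix.smul_mul, ih]
  | prepare r l p ih => simp only [probFrom, prepared_smul, ih]
  | measure r p ih => simp only [probFrom, measured_smul, ih, Finset.mul_sum]
  | random m p ih => simp only [probFrom, ih, ← Finset.mul_sum, mul_div_assoc]

theorem probFrom_sum {ι : Type*} (p : Algorithm d) (s : Finset ι) (ρ : ι → State d) :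
    p.probFrom Z E (∑ i ∈ s, ρ i) = ∑ i ∈ s, p.probFrom Z E (ρ i) :=
  map_sum (AddMonoidHom.mk' (p.probFrom Z E) (p.probFrom_add Z E)) ρ s

end Algorithm

/-! ### Pure states and the preparation and measurement of a register -/

/-- The density operator `|ψ⟩⟨ψ|` of the pure state with vector `ψ`. -/
def pureState {ι : Type*} (ψ : ι → ℂ) : Matrix ι ι ℂ := Matrix.vecMulVec ψ (star ψ)

theorem pureState_apply {ι : Type*} (ψ : ι → ℂ) (x y : ι) :
    pureState ψ x y = ψ x * star (ψ y) := rfl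

theorem mul_pureState_mul_conjTranspose {ι : Type*} [Fintype ι] (M : Matrix ι ι ℂ) (ψ : ι → ℂ) :
    M * pureState ψ * M.conjTranspose = pureState (M.mulVec ψ) := by
  rw [pureState, pureState, Matrix.mul_vecMulVec, Matrix.vecMulVec_mul, Matrix.star_mulVec]

theorem star_col_dotProduct_col {n : Type*} [Fintype n] [DecidableEq n]
    (V : Matrix.unitaryGroup n ℂ) (a : n) :
    star ((V : Matrix n n ℂ).col a) ⬝ᵥ (V : Matrix n n ℂ).col a = 1 := by
  simpa [Matrix.mul_apply, dotProduct, Matrix.star_apply] using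
    congrFun₂ (Matrix.mem_unitaryGroup_iff'.mp V.2) a a

theorem get_put (r : Register) (l : Level d r) (x : Basis d) : get r (put r l x) = l := by
  cases r <;> rfl

/-- The vector `φ ⊗ χ`, where `φ` is a vector of the register `r` and `χ`, a function that does not
depend on the content of `r`, is a vector of the other two registers. -/
def tensorAt (r : Register) (φ : Level d r → ℂ) (χ : Basis d → ℂ) : Basis d → ℂ :=
  fun x => φ (get r x) * χ x

theorem prepared_pureState_tensorAt {r : Register} {φ : Level d r → ℂ} (hφ : star φ ⬝ᵥ φ = 1)
    {χ : Basis d → ℂ} (hχ : ∀ k x, χ (put r k x) = χ x) (l : Level d r) :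
    prepared r l (pureState (tensorAt r φ χ)) = pureState (tensorAt r (Pi.single l 1) χ) := by
  have hsum (x y : Basis d) :
      ∑ k, φ k * χ x * star (φ k * χ y) = χ x * star (χ y) := by
    calc ∑ k, φ k * χ x * star (φ k * χ y) = (star φ ⬝ᵥ φ) * (χ x * star (χ y)) := by
          rw [dotProduct, Finset.sum_mul]
          exact Finset.sum_congr rfl fun k _ => by rw [star_mul', Pi.star_apply]; ring
      _ = _ := by rw [hφ, one_mul]
  ext x y
  simp only [prepared, Matrix.of_apply, pureState_apply, tensorAt, get_put, hχ, hsum]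
  by_cases hx : get r x = l <;> by_cases hy : get r y = l <;> simp [hx, hy]

theorem measured_pureState_tensorAt (r : Register) (l : Level d r) (φ : Level d r → ℂ)
    (χ : Basis d → ℂ) :
    measured r l (pureState (tensorAt r φ χ)) =
      Complex.normSq (φ l) • pureState (tensorAt r (Pi.single l 1) χ) := by
  ext x y
  simp only [measured, Matrix.of_apply, Matrix.smul_apply, pureState_apply, tensorAt]
  by_cases hx : get r x = l <;> by_cases hy : get r y = l <;>
    simp [hx, hy, ← Complex.mul_conj, mul_mul_mul_comm]

/-- All orthonormal bases of a register give the same mixture. -/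
theorem sum_pureState_tensorAt_col {r : Register} (V : Matrix.unitaryGroup (Level d r) ℂ)
    (χ : Basis d → ℂ) :
    ∑ a, pureState (tensorAt r ((V : Matrix (Level d r) (Level d r) ℂ).col a) χ) =
      Matrix.of fun x y => if get r x = get r y then χ x * star (χ y) else 0 := by
  ext x y
  have hrow : ∑ a, (V : Matrix (Level d r) (Level d r) ℂ) (get r x) a *
      star ((V : Matrix (Level d r) (Level d r) ℂ) (get r y) a) =
        if get r x = get r y then 1 else 0 := by
    rw [← Matrix.one_apply, ← Matrix.mem_unitaryGroup_iff.mp V.2, Matrix.mul_apply]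
    rfl
  calc (∑ a, pureState (tensorAt r ((V : Matrix (Level d r) (Level d r) ℂ).col a) χ)) x y
      = (∑ a, (V : Matrix (Level d r) (Level d r) ℂ) (get r x) a *
          star ((V : Matrix (Level d r) (Level d r) ℂ) (get r y) a)) * (χ x * star (χ y)) := by
        rw [Matrix.sum_apply, Finset.sum_mul]
        refine Finset.sum_congr rfl fun a _ => ?_
        rw [pureState_apply, tensorAt, tensorAt, star_mul', mul_mul_mul_comm]
        rfl
    _ = _ := by rw [hrow, ite_mul, one_mul, zero_mul, Matrix.of_apply]

/-- Replace the register `r`, whose basis states are labelled through `e`, by a maximally mixed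
one. -/
def refresh {m : ℕ} (r : Register) (e : Fin (m + 1) ≃ Level d r) (p : Algorithm d) : Algorithm d :=
  .random m fun i => .prepare r (e i) p

theorem probFrom_refresh {m : ℕ} {r : Register} (e : Fin (m + 1) ≃ Level d r) (p : Algorithm d)
    (Z : Matrix (Fin d) (Fin d) ℂ) (E : Finset ℝ → Prop) {φ : Level d r → ℂ}
    (hφ : star φ ⬝ᵥ φ = 1) {χ : Basis d → ℂ} (hχ : ∀ k x, χ (put r k x) = χ x)
    (V : Matrix.unitaryGroup (Level d r) ℂ) :
    (refresh r e p).probFrom Z E (pureState (tensorAt r φ χ)) =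
      (∑ a, p.probFrom Z E (pureState (tensorAt r
        ((V : Matrix (Level d r) (Level d r) ℂ).col a) χ))) / (m + 1 : ℝ) := by
  have hcol (l : Level d r) :
      (Pi.single l 1 : Level d r → ℂ) = ((1 : Matrix.unitaryGroup (Level d r) ℂ) :
        Matrix (Level d r) (Level d r) ℂ).col l := by
    rw [Matrix.UnitaryGroup.one_val, ← Matrix.mulVec_single_one, Matrix.one_mulVec]
  simp only [refresh, Algorithm.probFrom, prepared_pureState_tensorAt hφ hχ]
  rw [Equiv.sum_comp e fun l => p.probFrom Z E (pureState (tensorAt r (Pi.single l 1) χ)),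
    ← Algorithm.probFrom_sum, ← Algorithm.probFrom_sum, sum_pureState_tensorAt_col V χ,
    ← sum_pureState_tensorAt_col 1 χ]
  simp only [hcol]

/-! ### The Hadamard test -/

/-- The vector `u ⊗ v ⊗ c`. -/
def prodVec (u v : Fin d → ℂ) (c : Bool → ℂ) : Basis d → ℂ :=
  fun x => u x.1 * v x.2.1 * c x.2.2

/-- The state in which the two qudits hold `u` and `v` and the qubit holds `b`. -/
def prodState (u v : Fin d → ℂ) (b : Bool) : State d := pureState (prodVec u v (Pi.single b 1))

/-- The vector `c₀ u ⊗ v ⊗ e₀ + c₁ v ⊗ u ⊗ e₁`, which the controlled exchange makes of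
`u ⊗ v ⊗ c`. -/
def crossVec (u v : Fin d → ℂ) (c : Bool → ℂ) : Basis d → ℂ := prodVec u v c ∘ cswapLabel

theorem prodVec_eq_tensorAt_first (u v : Fin d → ℂ) (c : Bool → ℂ) :
    prodVec u v c = tensorAt .first u fun x => v x.2.1 * c x.2.2 :=
  funext fun _ => mul_assoc ..

theorem prodVec_eq_tensorAt_second (u v : Fin d → ℂ) (c : Bool → ℂ) :
    prodVec u v c = tensorAt .second v fun x => u x.1 * c x.2.2 :=
  funext fun x => show u x.1 * v x.2.1 * c x.2.2 = v x.2.1 * (u x.1 * c x.2.2) by ring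

theorem prodVec_eq_tensorAt_qubit (u v : Fin d → ℂ) (c : Bool → ℂ) :
    prodVec u v c = tensorAt .qubit c fun x => u x.1 * v x.2.1 :=
  funext fun _ => mul_comm ..

theorem prepared_qubit_prodState (u v : Fin d → ℂ) (b b' : Bool) :
    prepared .qubit b' (prodState u v b) = prodState u v b' := by
  rw [prodState, prodState, prodVec_eq_tensorAt_qubit, prodVec_eq_tensorAt_qubit]
  refine prepared_pureState_tensorAt (r := .qubit) ?_ (fun _ _ => rfl) b'
  change star (Pi.single b (1 : ℂ)) ⬝ᵥ (Pi.single b 1 : Bool → ℂ) = 1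
  simp

theorem measured_qubit_prodVec (u v : Fin d → ℂ) (c : Bool → ℂ) (b : Bool) :
    measured .qubit b (pureState (prodVec u v c)) = Complex.normSq (c b) • prodState u v b := by
  rw [prodState, prodVec_eq_tensorAt_qubit, prodVec_eq_tensorAt_qubit]
  exact measured_pureState_tensorAt .qubit b c _

theorem cswapOp_prodVec (u v : Fin d → ℂ) (c : Bool → ℂ) :
    ((cswapOp d).op : Matrix (Basis d) (Basis d) ℂ).mulVec (prodVec u v c) = crossVec u v c :=
  funext fun x => cswapOp_mulVec _ x

theorem cswapOp_crossVec (u v : Fin d → ℂ) (c : Bool → ℂ) :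
    ((cswapOp d).op : Matrix (Basis d) (Basis d) ℂ).mulVec (crossVec u v c) = prodVec u v c :=
  funext fun x => by
    rw [cswapOp_mulVec, crossVec, Function.comp_apply, cswapLabel_involutive x]

theorem qubitOp_prodVec (U : Matrix.unitaryGroup Bool ℂ) (u v : Fin d → ℂ) (c : Bool → ℂ) :
    ((qubitOp d U).op : Matrix (Basis d) (Basis d) ℂ).mulVec (prodVec u v c) =
      prodVec u v ((U : Matrix Bool Bool ℂ).mulVec c) := by
  ext x
  rw [qubitOp_mulVec]
  simp only [prodVec, Matrix.mulVec, dotProduct, Finset.mul_sum]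
  exact Finset.sum_congr rfl fun b _ => by ring

theorem onFirst_mulVec (Z : Matrix (Fin d) (Fin d) ℂ) (ψ : Basis d → ℂ) (x : Basis d) :
    (onFirst Z).mulVec ψ x = Z.mulVec (fun i => ψ (i, x.2)) x.1 := by
  simp only [onFirst, kronecker_mulVec_apply, Matrix.one_apply, ite_mul, one_mul, zero_mul,
    Finset.sum_ite_eq, Finset.mem_univ, if_true]
  rfl

/-- Applied to the first qudit only, `Z` multiplies the two branches of `crossVec u v c` by the
eigenvalues of `u` and `v`: no controlled application of `Z` is needed. -/
theorem onFirst_crossVec {Z : Matrix (Fin d) (Fin d) ℂ} {u v : Fin d → ℂ} {μ ν : ℂ}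
    (hu : Z.mulVec u = μ • u) (hv : Z.mulVec v = ν • v) (c : Bool → ℂ) :
    (onFirst Z).mulVec (crossVec u v c) = crossVec u v fun b => (if b then ν else μ) * c b := by
  ext ⟨i, j, b⟩
  rw [onFirst_mulVec]
  cases b
  · have h : (fun k => crossVec u v c (k, j, false)) = (v j * c false) • u := by
      ext k; simp only [crossVec, prodVec, cswapLabel, Function.comp_apply, Pi.smul_apply,
        smul_eq_mul, Bool.false_eq_true, if_false]; ring
    rw [h, Matrix.mulVec_smul, hu]
    simp only [crossVec, prodVec, cswapLabel, Function.comp_apply, Pi.smul_apply,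
        smul_eq_mul, Bool.false_eq_true, if_false]
    ring
  · have h : (fun k => crossVec u v c (k, j, true)) = (u j * c true) • v := by
      ext k; simp only [crossVec, prodVec, cswapLabel, Function.comp_apply, Pi.smul_apply,
        smul_eq_mul, if_true]; ring
    rw [h, Matrix.mulVec_smul, hv]
    simp only [crossVec, prodVec, cswapLabel, Function.comp_apply, Pi.smul_apply,
        smul_eq_mul, if_true]
    ring

/-- Apply the unknown unitary `t` times. -/
def queryPow : ℕ → Algorithm d → Algorithm d
  | 0, p => p
  | t + 1, p => .query (queryPow t p)

theorem probFrom_queryPow {Z : Matrix (Fin d) (Fin d) ℂ} (E : Finset ℝ → Prop)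
    {u v : Fin d → ℂ} {μ ν : ℂ} (hu : Z.mulVec u = μ • u) (hv : Z.mulVec v = ν • v)
    (t : ℕ) (p : Algorithm d) (c : Bool → ℂ) :
    (queryPow t p).probFrom Z E (pureState (crossVec u v c)) =
      p.probFrom Z E (pureState (crossVec u v fun b => (if b then ν else μ) ^ t * c b)) := by
  induction t generalizing c with
  | zero => simp only [queryPow, pow_zero, one_mul]
  | succ t ih =>
    rw [queryPow, Algorithm.probFrom, mul_pureState_mul_conjTranspose, onFirst_crossVec hu hv, ih]
    simp only [pow_succ, mul_assoc]

/-- The value `± 1` of an outcome. -/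
def sign (b : Bool) : ℝ := if b then -1 else 1

theorem inv_sqrt_two_mul_self : ((√2 : ℝ) : ℂ)⁻¹ * ((√2 : ℝ) : ℂ)⁻¹ = 1 / 2 := by
  rw [← mul_inv, ← Complex.ofReal_mul, Real.mul_self_sqrt zero_le_two, Complex.ofReal_ofNat,
    one_div]

/-- The phase gate `diag (1, s)`, followed by the Hadamard gate. -/
def hadamardUnitary (s : unitary ℂ) : Matrix.unitaryGroup Bool ℂ :=
  ⟨Matrix.of fun p q => ((√2 : ℝ) : ℂ)⁻¹ * if q then sign p * (s : ℂ) else 1, by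
    rw [Matrix.mem_unitaryGroup_iff]
    have hs : (s : ℂ) * star (s : ℂ) = 1 := Unitary.mul_star_self_of_mem s.2
    have hr : star ((√2 : ℝ) : ℂ)⁻¹ = ((√2 : ℝ) : ℂ)⁻¹ := by
      rw [star_inv₀, Complex.star_def, Complex.conj_ofReal]
    ext p q
    rw [Matrix.mul_apply, Fintype.sum_bool]
    have hmul : ((√2 : ℝ) : ℂ)⁻¹ * ((√2 : ℝ) : ℂ)⁻¹ = 1 / 2 := inv_sqrt_two_mul_self
    generalize ((√2 : ℝ) : ℂ)⁻¹ = r at hr hmul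
    generalize (s : ℂ) = z at hs
    rw [Complex.star_def] at hs
    cases p <;> cases q <;> simp [Matrix.star_apply, sign, hr]
    · linear_combination 2 * hmul + r * r * hs
    · linear_combination -r * r * hs
    · linear_combination -r * r * hs
    · linear_combination 2 * hmul + r * r * hs⟩

theorem hadamardUnitary_mulVec (s : unitary ℂ) (c : Bool → ℂ) (b : Bool) :
    (hadamardUnitary s : Matrix Bool Bool ℂ).mulVec c b =
      ((√2 : ℝ) : ℂ)⁻¹ * (c false + sign b * s * c true) := by
  simp only [hadamardUnitary, Matrix.mulVec, dotProduct, Matrix.of_apply, Fintype.sum_bool,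
    if_true, Bool.false_eq_true, if_false]
  ring

/-- A Hadamard test of the ratio of the eigenvalues of the contents of the two qudits, with the
power `t` of the unknown unitary. The phase `s` selects the cosine or the sine of the phase of the
ratio. -/
def hadamardTest (s : unitary ℂ) (t : ℕ) (next : Bool → Algorithm d) : Algorithm d :=
  .prepare .qubit false <| .apply (qubitOp d (hadamardUnitary 1)) <| .apply (cswapOp d) <|
    queryPow t <| .apply (cswapOp d) <| .apply (qubitOp d (hadamardUnitary s)) <|
    .measure .qubit next

/-- The vectors `u` and `v` are eigenvectors of `Z` for eigenvalues on the unit circle that differ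
by the phase `ω`. -/
def IsEigenpair (Z : Matrix (Fin d) (Fin d) ℂ) (u v : Fin d → ℂ) (ω : ℝ) : Prop :=
  ∃ μ : ℂ, ‖μ‖ = 1 ∧ Z.mulVec u = μ • u ∧ Z.mulVec v = (μ * Complex.exp (ω * Complex.I)) • v

/-- The expectation of the outcome `± 1` of a Hadamard test on a pair of eigenvectors, if the
eigenvalues of the power of the unknown unitary differ by the phase `x`. -/
def testMean (s : unitary ℂ) (x : ℝ) : ℝ := ((s : ℂ) * Complex.exp (x * Complex.I)).re

theorem norm_mul_exp_eq_one (s : unitary ℂ) (x : ℝ) :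
    ‖(s : ℂ) * Complex.exp (x * Complex.I)‖ = 1 := by
  rw [norm_mul, Complex.norm_exp_ofReal_mul_I, mul_one, CStarRing.norm_of_mem_unitary s.2]

theorem abs_testMean_le (s : unitary ℂ) (x : ℝ) : |testMean s x| ≤ 1 :=
  (Complex.abs_re_le_norm _).trans (norm_mul_exp_eq_one s x).le

theorem normSq_one_add_sign_mul {w : ℂ} (hw : ‖w‖ = 1) (b : Bool) :
    Complex.normSq (1 + sign b * w) = 2 * (1 + sign b * w.re) := by
  have hw' : w.re * w.re + w.im * w.im = 1 := by
    rw [← Complex.normSq_apply, Complex.normSq_eq_norm_sq, hw, one_pow]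
  rw [Complex.normSq_apply]
  cases b <;> simp [sign] <;> linear_combination hw'

theorem normSq_hadamardTest_amplitude (s : unitary ℂ) (t : ℕ) {μ : ℂ} (hμ : ‖μ‖ = 1) (ω : ℝ)
    (b : Bool) :
    Complex.normSq (((√2 : ℝ) : ℂ)⁻¹ * (μ ^ t * ((√2 : ℝ) : ℂ)⁻¹ +
      sign b * s * ((μ * Complex.exp (ω * Complex.I)) ^ t * ((√2 : ℝ) : ℂ)⁻¹))) =
      (1 + sign b * testMean s (t * ω)) / 2 := by
  have hexp : Complex.exp (ω * Complex.I) ^ t = Complex.exp ((t * ω : ℝ) * Complex.I) := by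
    rw [← Complex.exp_nat_mul]
    push_cast
    ring_nf
  have hfactor : ((√2 : ℝ) : ℂ)⁻¹ * (μ ^ t * ((√2 : ℝ) : ℂ)⁻¹ +
      sign b * s * ((μ * Complex.exp (ω * Complex.I)) ^ t * ((√2 : ℝ) : ℂ)⁻¹)) =
      1 / 2 * (μ ^ t * (1 + sign b * (s * Complex.exp ((t * ω : ℝ) * Complex.I)))) := by
    rw [← inv_sqrt_two_mul_self, mul_pow, hexp]
    ring
  rw [hfactor, Complex.normSq_mul, Complex.normSq_mul,
    normSq_one_add_sign_mul (norm_mul_exp_eq_one ..), Complex.normSq_eq_norm_sq (μ ^ t), norm_pow,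
    hμ, testMean]
  norm_num
  ring

theorem IsEigenpair.probFrom_hadamardTest {Z : Matrix (Fin d) (Fin d) ℂ} {u v : Fin d → ℂ} {ω : ℝ}
    (h : IsEigenpair Z u v ω) (E : Finset ℝ → Prop) (s : unitary ℂ) (t : ℕ)
    (next : Bool → Algorithm d) (b₀ : Bool) :
    (hadamardTest s t next).probFrom Z E (prodState u v b₀) =
      ∑ b, (1 + sign b * testMean s (t * ω)) / 2 * (next b).probFrom Z E (prodState u v b) := by
  obtain ⟨μ, hμ, hu, hv⟩ := h
  simp only [hadamardTest, Algorithm.probFrom, prepared_qubit_prodState]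
  rw [prodState, mul_pureState_mul_conjTranspose, qubitOp_prodVec,
    mul_pureState_mul_conjTranspose, cswapOp_prodVec, probFrom_queryPow E hu hv]
  simp only [Algorithm.probFrom, mul_pureState_mul_conjTranspose, cswapOp_crossVec,
    qubitOp_prodVec]
  refine Finset.sum_congr rfl fun b _ => ?_
  rw [measured_qubit_prodVec, Algorithm.probFrom_smul, hadamardUnitary_mulVec,
    ← normSq_hadamardTest_amplitude s t hμ]
  simp [hadamardUnitary_mulVec]

/-! ### Concentration of random walks -/

open Classical in
/-- The indicator of a proposition, as a real number. -/
def ind (P : Prop) : ℝ := if P then 1 else 0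

theorem ind_nonneg (P : Prop) : 0 ≤ ind P := by
  rw [ind]; split_ifs <;> norm_num

theorem ind_le_one (P : Prop) : ind P ≤ 1 := by
  rw [ind]; split_ifs <;> norm_num

theorem ind_mono {P Q : Prop} (h : P → Q) : ind P ≤ ind Q := by
  by_cases hP : P
  · rw [ind, ind, if_pos hP, if_pos (h hP)]
  · rw [ind, if_neg hP]; exact ind_nonneg Q

theorem ind_or_le (P Q : Prop) : ind (P ∨ Q) ≤ ind P + ind Q := by
  by_cases hP : P <;> by_cases hQ : Q <;> simp [ind, hP, hQ]

theorem ind_exists_le_sum {ι : Type*} [Fintype ι] (P : ι → Prop) :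
    ind (∃ i, P i) ≤ ∑ i, ind (P i) := by
  by_cases h : ∃ i, P i
  · obtain ⟨i, hi⟩ := h
    calc ind (∃ i, P i) ≤ ind (P i) := ind_mono fun _ => hi
      _ ≤ _ := Finset.single_le_sum (f := fun i => ind (P i)) (fun i _ => ind_nonneg _)
        (Finset.mem_univ i)
  · rw [ind, if_neg h]
    exact Finset.sum_nonneg fun i _ => ind_nonneg _

/-- The transition operator of the random walk on `ℝ` whose steps are `± 1` and have mean `q`. -/
def randomWalk (q : ℝ) : (ℝ → ℝ) →ₗ[ℝ] ℝ → ℝ where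
  toFun f x := (1 + q) / 2 * f (x + 1) + (1 - q) / 2 * f (x - 1)
  map_add' f g := by ext x; simp only [Pi.add_apply]; ring
  map_smul' c f := by ext x; simp only [Pi.smul_apply, smul_eq_mul, RingHom.id_apply]; ring

theorem randomWalk_apply (q : ℝ) (f : ℝ → ℝ) (x : ℝ) :
    randomWalk q f x = (1 + q) / 2 * f (x + 1) + (1 - q) / 2 * f (x - 1) := rfl

theorem randomWalk_mono {q : ℝ} (hq : |q| ≤ 1) : Monotone (randomWalk q) := by
  intro f g hfg x
  rw [abs_le] at hq
  have hp : 0 ≤ (1 + q) / 2 := by linarith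
  have hm : 0 ≤ (1 - q) / 2 := by linarith
  exact add_le_add (mul_le_mul_of_nonneg_left (hfg _) hp) (mul_le_mul_of_nonneg_left (hfg _) hm)

theorem randomWalk_pow_mono {q : ℝ} (hq : |q| ≤ 1) (m : ℕ) : Monotone (randomWalk q ^ m) := by
  rw [Module.End.coe_pow]
  exact (randomWalk_mono hq).iterate m

theorem randomWalk_pow_const (q : ℝ) (m : ℕ) (a : ℝ) :
    (randomWalk q ^ m) (fun _ => a) = fun _ => a := by
  rw [Module.End.coe_pow]
  refine Function.iterate_fixed (funext fun x => ?_) m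
  rw [randomWalk_apply]
  ring

/-- The moment generating function of a step of the random walk with mean `q`. -/
def stepMGF (q r : ℝ) : ℝ := (1 + q) / 2 * Real.exp r + (1 - q) / 2 * Real.exp (-r)

theorem stepMGF_nonneg {q : ℝ} (hq : |q| ≤ 1) (r : ℝ) : 0 ≤ stepMGF q r := by
  rw [abs_le] at hq
  have hp : 0 ≤ (1 + q) / 2 := by linarith
  have hm : 0 ≤ (1 - q) / 2 := by linarith
  rw [stepMGF]
  positivity

theorem randomWalk_pow_exp (q r a : ℝ) (m : ℕ) :
    (randomWalk q ^ m) (fun x => Real.exp (r * (x - a))) =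
      stepMGF q r ^ m • fun x => Real.exp (r * (x - a)) := by
  have heigen : randomWalk q (fun x => Real.exp (r * (x - a))) =
      stepMGF q r • fun x => Real.exp (r * (x - a)) := by
    ext x
    rw [randomWalk_apply, show r * (x + 1 - a) = r * (x - a) + r by ring,
      show r * (x - 1 - a) = r * (x - a) + -r by ring, Real.exp_add, Real.exp_add, Pi.smul_apply,
      smul_eq_mul, stepMGF]
    ring
  induction m with
  | zero => simp
  | succ m ih => rw [pow_succ', Module.End.mul_apply, ih, map_smul, heigen, smul_smul, ← pow_succ]

theorem stepMGF_le {q r : ℝ} (hq : |q| ≤ 1) (hr : |r| ≤ 1 / 2) :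
    stepMGF q r ≤ Real.exp (r * q + r ^ 2) := by
  have hquad {z : ℝ} (hz : |z| ≤ 1) : Real.exp z ≤ 1 + z + z ^ 2 := by
    linarith [(abs_le.mp (Real.abs_exp_sub_one_sub_id_le hz)).2]
  obtain ⟨hq₁, hq₂⟩ := abs_le.mp hq
  have hplus : |r * (1 - q)| ≤ 1 := by
    rw [abs_mul, abs_of_nonneg (sub_nonneg.mpr hq₂)]
    nlinarith [abs_nonneg r]
  have hminus : |-(r * (1 + q))| ≤ 1 := by
    rw [abs_neg, abs_mul, abs_of_nonneg (by linarith : 0 ≤ 1 + q)]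
    nlinarith [abs_nonneg r]
  have hcentred : (1 + q) / 2 * Real.exp (r * (1 - q)) + (1 - q) / 2 * Real.exp (-(r * (1 + q))) ≤
      Real.exp (r ^ 2) := by
    have h₁ := mul_le_mul_of_nonneg_left (hquad hplus) (by linarith : 0 ≤ (1 + q) / 2)
    have h₂ := mul_le_mul_of_nonneg_left (hquad hminus) (by linarith : 0 ≤ (1 - q) / 2)
    nlinarith [Real.add_one_le_exp (r ^ 2), mul_nonneg (sq_nonneg r) (sq_nonneg q)]
  calc stepMGF q r = Real.exp (r * q) * ((1 + q) / 2 * Real.exp (r * (1 - q)) +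
        (1 - q) / 2 * Real.exp (-(r * (1 + q)))) := by
        rw [stepMGF, mul_add, mul_left_comm, ← Real.exp_add, mul_left_comm, ← Real.exp_add]
        ring_nf
    _ ≤ Real.exp (r * q) * Real.exp (r ^ 2) :=
        mul_le_mul_of_nonneg_left hcentred (Real.exp_nonneg _)
    _ = _ := (Real.exp_add ..).symm

theorem randomWalk_pow_exp_zero_le {q r : ℝ} (hq : |q| ≤ 1) (hr : |r| ≤ 1 / 2) (a : ℝ) (m : ℕ) :
    (randomWalk q ^ m) (fun x => Real.exp (r * (x - a))) 0 ≤
      Real.exp (m * (r * q + r ^ 2) - r * a) := by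
  calc _ = stepMGF q r ^ m * Real.exp (-(r * a)) := by
        rw [randomWalk_pow_exp, Pi.smul_apply, smul_eq_mul, zero_sub, mul_neg]
    _ ≤ Real.exp (r * q + r ^ 2) ^ m * Real.exp (-(r * a)) := by
        gcongr
        · exact stepMGF_nonneg hq r
        · exact stepMGF_le hq hr
    _ = _ := by rw [← Real.exp_nat_mul, ← Real.exp_add, sub_eq_add_neg]

theorem ind_not_abs_sub_le_le_exp_add_exp (x a c : ℝ) {r : ℝ} (hr : 0 ≤ r) :
    ind (¬|x - a| ≤ c) ≤ Real.exp (r * (x - (a + c))) + Real.exp (-r * (x - (a - c))) := by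
  by_cases h : |x - a| ≤ c
  · rw [ind, if_neg (not_not.mpr h)]
    positivity
  rw [ind, if_pos h]
  rw [not_le, lt_abs] at h
  rcases h with h | h
  · exact le_add_of_le_of_nonneg (Real.one_le_exp (mul_nonneg hr (by linarith)))
      (Real.exp_nonneg _)
  · exact le_add_of_nonneg_of_le (Real.exp_nonneg _) (Real.one_le_exp
      (mul_nonneg_of_nonpos_of_nonpos (neg_nonpos.mpr hr) (by linarith)))

theorem randomWalk_pow_ind_not_abs_sub_le_le {q δ : ℝ} (hq : |q| ≤ 1) (hδ₀ : 0 ≤ δ) (hδ₁ : δ ≤ 1)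
    (m : ℕ) :
    (randomWalk q ^ m) (fun x => ind (¬|x - m * q| ≤ m * δ)) 0 ≤
      2 * Real.exp (-(m * δ ^ 2 / 4)) := by
  have hr : |δ / 2| ≤ 1 / 2 := by rw [abs_of_nonneg (by linarith)]; linarith
  have hr' : |-(δ / 2)| ≤ 1 / 2 := by rwa [abs_neg]
  calc _ ≤ (randomWalk q ^ m) ((fun x => Real.exp (δ / 2 * (x - (m * q + m * δ)))) +
        fun x => Real.exp (-(δ / 2) * (x - (m * q - m * δ)))) 0 :=
        randomWalk_pow_mono hq m (fun x =>
          ind_not_abs_sub_le_le_exp_add_exp x (m * q) (m * δ) (div_nonneg hδ₀ zero_le_two)) 0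
    _ ≤ Real.exp (m * (δ / 2 * q + (δ / 2) ^ 2) - δ / 2 * (m * q + m * δ)) +
        Real.exp (m * (-(δ / 2) * q + (-(δ / 2)) ^ 2) - -(δ / 2) * (m * q - m * δ)) := by
        rw [map_add, Pi.add_apply]
        exact add_le_add (randomWalk_pow_exp_zero_le hq hr _ m)
          (randomWalk_pow_exp_zero_le hq hr' _ m)
    _ = _ := by ring_nf

/-! ### Repeated tests -/

/-- Started with `u ⊗ v` in the two qudits, the algorithm `p` outputs a set with property `E`
with probability at most `c`. -/
def ProbLE (Z : Matrix (Fin d) (Fin d) ℂ) (E : Finset ℝ → Prop) (u v : Fin d → ℂ)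
    (p : Algorithm d) (c : ℝ) : Prop :=
  ∀ b, p.probFrom Z E (prodState u v b) ≤ c

/-- Perform `m` Hadamard tests, and add the outcomes `± 1` to the counter `n`. -/
def repeatTest (s : unitary ℂ) (t : ℕ) : ℕ → ℝ → (ℝ → Algorithm d) → Algorithm d
  | 0, n, next => next n
  | m + 1, n, next => hadamardTest s t fun b => repeatTest s t m (n + sign b) next

/-- The phase `-i`, for which the mean of the Hadamard test is the sine of the relative phase. -/
def negI : unitary ℂ := ⟨-Complex.I, by simp [Unitary.mem_iff]⟩

theorem testMean_one (x : ℝ) : testMean 1 x = Real.cos x := by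
  simp [testMean, Complex.exp_ofReal_mul_I_re]

theorem testMean_negI (x : ℝ) : testMean negI x = Real.sin x := by
  simp [testMean, negI, Complex.exp_ofReal_mul_I_im]

/-- The phases `x` for which `m cos (t x)` and `m sin (t x)` are close to the observed sums
`c` and `c'` of `m` test outcomes. -/
def consistentPhases (m t : ℕ) (c c' : ℝ) : Set ℝ :=
  {x | |c - m * Real.cos (t * x)| ≤ m * (1 / 3) ∧ |c' - m * Real.sin (t * x)| ≤ m * (1 / 3)}

/-- Determine by `2 * m` Hadamard tests the phases that `t` times the relative phase may have. -/
def measurePhase (m t : ℕ) (next : Set ℝ → Algorithm d) : Algorithm d :=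
  repeatTest 1 t m 0 fun c => repeatTest negI t m 0 fun c' => next (consistentPhases m t c c')

section

variable {Z : Matrix (Fin d) (Fin d) ℂ} {E : Finset ℝ → Prop} {u v : Fin d → ℂ} {ω : ℝ}

theorem ProbLE.mono {p : Algorithm d} {c c' : ℝ} (h : ProbLE Z E u v p c) (hc : c ≤ c') :
    ProbLE Z E u v p c' :=
  fun b => (h b).trans hc

theorem IsEigenpair.probLE_hadamardTest (h : IsEigenpair Z u v ω) (s : unitary ℂ) (t : ℕ)
    {next : Bool → Algorithm d} {c : Bool → ℝ} (hc : ∀ b, ProbLE Z E u v (next b) (c b)) :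
    ProbLE Z E u v (hadamardTest s t next)
      (∑ b, (1 + sign b * testMean s (t * ω)) / 2 * c b) := by
  intro b₀
  rw [h.probFrom_hadamardTest]
  refine Finset.sum_le_sum fun b _ => mul_le_mul_of_nonneg_left (hc b b) ?_
  obtain ⟨hlower, hupper⟩ := abs_le.mp (abs_testMean_le s (t * ω))
  cases b <;> simp only [sign, if_true, Bool.false_eq_true, if_false] <;> linarith

theorem IsEigenpair.probLE_repeatTest (h : IsEigenpair Z u v ω) (s : unitary ℂ) (t m : ℕ)
    {next : ℝ → Algorithm d} {f : ℝ → ℝ} (hnext : ∀ n, ProbLE Z E u v (next n) (f n)) (n : ℝ) :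
    ProbLE Z E u v (repeatTest s t m n next) ((randomWalk (testMean s (t * ω)) ^ m) f n) := by
  induction m generalizing n with
  | zero => exact hnext n
  | succ m ih =>
    refine (h.probLE_hadamardTest s t fun b => ih (n + sign b)).mono (le_of_eq ?_)
    rw [pow_succ', Module.End.mul_apply, randomWalk_apply, Fintype.sum_bool]
    simp only [sign, if_true, Bool.false_eq_true, if_false]
    ring_nf

theorem IsEigenpair.probLE_repeatTest_of_concentrated (h : IsEigenpair Z u v ω) (s : unitary ℂ)
    (t m : ℕ) {A B δ : ℝ} (hB : 0 ≤ B) (hδ₀ : 0 ≤ δ) (hδ₁ : δ ≤ 1) {next : ℝ → Algorithm d}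
    (hnext : ∀ n, ProbLE Z E u v (next n)
      (A + B * ind (¬|n - m * testMean s (t * ω)| ≤ m * δ))) :
    ProbLE Z E u v (repeatTest s t m 0 next) (A + B * (2 * Real.exp (-(m * δ ^ 2 / 4)))) := by
  set q := testMean s (t * ω)
  refine (h.probLE_repeatTest s t m hnext 0).mono ?_
  calc (randomWalk q ^ m) ((fun _ => A) + B • fun n => ind (¬|n - m * q| ≤ m * δ)) 0
      = A + B * (randomWalk q ^ m) (fun n => ind (¬|n - m * q| ≤ m * δ)) 0 := by
        rw [map_add, map_smul, randomWalk_pow_const]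
        rfl
    _ ≤ _ := by
        gcongr
        exact randomWalk_pow_ind_not_abs_sub_le_le (abs_testMean_le ..) hδ₀ hδ₁ m

theorem IsEigenpair.probLE_measurePhase (h : IsEigenpair Z u v ω) (m t : ℕ) {A B : ℝ}
    (hB : 0 ≤ B) {next : Set ℝ → Algorithm d}
    (hnext : ∀ c c', ProbLE Z E u v (next (consistentPhases m t c c'))
      (A + B * ind (ω ∉ consistentPhases m t c c'))) :
    ProbLE Z E u v (measurePhase m t next) (A + B * (4 * Real.exp (-(m / 36)))) := by
  have hunion (c c' : ℝ) : A + B * ind (ω ∉ consistentPhases m t c c') ≤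
      (A + B * ind (¬|c - m * testMean 1 (t * ω)| ≤ m * (1 / 3))) +
        B * ind (¬|c' - m * testMean negI (t * ω)| ≤ m * (1 / 3)) := by
    rw [add_assoc, ← mul_add, testMean_one, testMean_negI]
    gcongr
    exact (ind_mono not_and_or.mp).trans (ind_or_le _ _)
  refine (h.probLE_repeatTest_of_concentrated 1 t m hB (by norm_num) (by norm_num) fun c =>
    (h.probLE_repeatTest_of_concentrated negI t m hB (by norm_num) (by norm_num) fun c' =>
      (hnext c c').mono (hunion c c')).mono (add_right_comm ..).le).mono (le_of_eq ?_)
  rw [show (m * (1 / 3) ^ 2 / 4 : ℝ) = m / 36 by ring]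
  ring

end

/-! ### Phase estimation -/

theorem abs_le_pi_div_three {z : ℝ} (hz : |z| ≤ Real.pi) (h : 1 / 2 ≤ Real.cos z) :
    |z| ≤ Real.pi / 3 := by
  by_contra! hlt
  have := Real.cos_lt_cos_of_nonneg_of_le_pi (by positivity) hz hlt
  rw [Real.cos_abs, Real.cos_pi_div_three] at this
  linarith

theorem abs_two_pow_mul_le_pi_div_three {y : ℝ} (hy : |y| ≤ Real.pi) {J : ℕ}
    (h : ∀ j ≤ J, 1 / 2 ≤ Real.cos (2 ^ j * y)) : |2 ^ J * y| ≤ Real.pi / 3 := by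
  induction J with
  | zero =>
    refine abs_le_pi_div_three ?_ (h 0 le_rfl)
    rwa [pow_zero, one_mul]
  | succ J ih =>
    refine abs_le_pi_div_three ?_ (h _ le_rfl)
    have hprev := ih fun j hj => h j (hj.trans J.le_succ)
    rw [pow_succ', mul_assoc, abs_mul, abs_two]
    linarith [Real.pi_pos]

theorem norm_coe_le_of_half_le_cos {x : ℝ} {J : ℕ}
    (h : ∀ j ≤ J, 1 / 2 ≤ Real.cos (2 ^ j * x)) :
    ‖(x : AddCircle (2 * Real.pi))‖ ≤ Real.pi / 3 / 2 ^ J := by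
  have hle := AddCircle.norm_le_half_period (2 * Real.pi) Real.two_pi_pos.ne'
    (x := (x : AddCircle (2 * Real.pi)))
  rw [AddCircle.norm_eq] at hle ⊢
  rw [abs_of_pos Real.two_pi_pos, mul_div_cancel_left₀ _ two_ne_zero] at hle
  generalize round ((2 * Real.pi)⁻¹ * x) = k at hle ⊢
  have hcos (j : ℕ) : Real.cos (2 ^ j * (x - k * (2 * Real.pi))) = Real.cos (2 ^ j * x) := by
    rw [← Real.cos_sub_int_mul_two_pi (2 ^ j * x) (2 ^ j * k)]
    push_cast
    ring_nf
  have hscaled := abs_two_pow_mul_le_pi_div_three hle fun j hj => (h j hj).trans_eq (hcos j).symm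
  rw [abs_mul, abs_of_pos (by positivity)] at hscaled
  rwa [le_div_iff₀' (by positivity)]

theorem half_le_cos_sub_of_mem_consistentPhases {m t : ℕ} {c c' x y : ℝ} (hm : 0 < m)
    (hx : x ∈ consistentPhases m t c c') (hy : y ∈ consistentPhases m t c c') :
    1 / 2 ≤ Real.cos (t * (x - y)) := by
  have hm' : (0 : ℝ) < m := by exact_mod_cast hm
  have hclose {a p q : ℝ} (hp : |a - m * p| ≤ m * (1 / 3)) (hq : |a - m * q| ≤ m * (1 / 3)) :
      (p - q) ^ 2 ≤ (2 / 3) ^ 2 := by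
    rw [abs_le] at hp hq
    apply sq_le_sq' <;> nlinarith
  rw [mul_sub, Real.cos_sub]
  nlinarith [hclose hx.1 hy.1, hclose hx.2 hy.2, Real.sin_sq_add_cos_sq (t * x),
    Real.sin_sq_add_cos_sq (t * y)]

/-- The multiples of elements of `S` by `2 ^ i`, for `i < j`, differ by at most `π / 3` modulo
`2π`. -/
def IsResolved (j : ℕ) (S : Set ℝ) : Prop :=
  ∀ i < j, ∀ x ∈ S, ∀ y ∈ S, 1 / 2 ≤ Real.cos (2 ^ i * (x - y))

theorem isResolved_zero (S : Set ℝ) : IsResolved 0 S := fun i hi => absurd hi i.not_lt_zero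

theorem IsResolved.succ {j : ℕ} {S : Set ℝ} (h : IsResolved j S) {m : ℕ} (hm : 0 < m)
    {c c' : ℝ} (hS : S ⊆ consistentPhases m (2 ^ j) c c') : IsResolved (j + 1) S := by
  intro i hi x hx y hy
  rcases Nat.lt_succ_iff_lt_or_eq.mp hi with hi | rfl
  · exact h i hi x hx y hy
  · exact_mod_cast half_le_cos_sub_of_mem_consistentPhases hm (hS hx) (hS hy)

theorem IsResolved.norm_coe_sub_le {J : ℕ} {S : Set ℝ} (h : IsResolved (J + 1) S) {x y : ℝ}
    (hx : x ∈ S) (hy : y ∈ S) :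
    ‖((x - y : ℝ) : AddCircle (2 * Real.pi))‖ ≤ Real.pi / 3 / 2 ^ J :=
  norm_coe_le_of_half_le_cos fun j hj => h j (Nat.lt_succ_of_le hj) x hx y hy

/-- The number of repetitions for the power `2 ^ j` of the unknown unitary. Low powers are cheap,
so they are tested more often. -/
def reps (K J j : ℕ) : ℕ := 36 * (K + (J - j))

theorem reps_pos {K : ℕ} (hK : 0 < K) (J j : ℕ) : 0 < reps K J j := by
  rw [reps]; omega

theorem exp_neg_reps_div_le (K : ℕ) {J j : ℕ} (hj : j ≤ J) :
    Real.exp (-(reps K J j / 36)) ≤ (1 / 2) ^ K * (2 ^ j / 2 ^ J) := by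
  have hpow : (2 : ℝ) ^ J = 2 ^ (J - j) * 2 ^ j := by rw [← pow_add, Nat.sub_add_cancel hj]
  calc Real.exp (-(reps K J j / 36)) = Real.exp (-1) ^ (K + (J - j)) := by
        rw [← Real.exp_nat_mul, reps]
        push_cast
        ring_nf
    _ ≤ (1 / 2) ^ (K + (J - j)) :=
        pow_le_pow_left₀ (Real.exp_nonneg _) Real.exp_neg_one_lt_half.le _
    _ = _ := by
        rw [pow_add, hpow, one_div_pow (2 : ℝ) (J - j)]
        field_simp

/-- The elements of `S` that are consistent with the outcomes of the tests for the powers `2 ^ i`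
of the unknown unitary, `i < j`. -/
def estimate (K J : ℕ) : ℕ → Set ℝ → (Set ℝ → Algorithm d) → Algorithm d
  | 0, S, next => next S
  | j + 1, S, next => measurePhase (reps K J j) (2 ^ j) fun C => estimate K J j (S ∩ C) next

theorem IsEigenpair.probLE_estimate {Z : Matrix (Fin d) (Fin d) ℂ} {E : Finset ℝ → Prop}
    {u v : Fin d → ℂ} {ω : ℝ} (h : IsEigenpair Z u v ω) {K J : ℕ} (hK : 0 < K) {A B : ℝ}
    (hB : 0 ≤ B) {next : Set ℝ → Algorithm d} {j : ℕ} (hj : j ≤ J + 1) {S : Set ℝ}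
    (hnext : ∀ S' ⊆ S, IsResolved j S' → ProbLE Z E u v (next S') (A + B * ind (ω ∉ S'))) :
    ProbLE Z E u v (estimate K J j S next)
      (A + B * (ind (ω ∉ S) + 4 * (1 / 2) ^ K * (2 ^ j / 2 ^ J))) := by
  induction j generalizing S with
  | zero =>
    refine (hnext S le_rfl (isResolved_zero S)).mono ?_
    gcongr
    exact le_add_of_nonneg_right (by positivity)
  | succ j ih =>
    set δ := 4 * (1 / 2 : ℝ) ^ K * (2 ^ j / 2 ^ J) with hδ
    have hinter (C : Set ℝ) : A + B * (ind (ω ∉ S ∩ C) + δ) ≤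
        (A + B * (ind (ω ∉ S) + δ)) + B * ind (ω ∉ C) := by
      rw [add_assoc, ← mul_add, add_right_comm]
      gcongr
      exact (ind_mono not_and_or.mp).trans (ind_or_le _ _)
    have hstep (c c' : ℝ) := (ih (by omega) fun S' hS' hres =>
      hnext S' (hS'.trans Set.inter_subset_left) <|
        hres.succ (reps_pos hK J j) (hS'.trans Set.inter_subset_right)).mono
      (hinter (consistentPhases (reps K J j) (2 ^ j) c c'))
    refine (h.probLE_measurePhase (reps K J j) (2 ^ j) hB hstep).mono ?_
    calc A + B * (ind (ω ∉ S) + δ) + B * (4 * Real.exp (-(reps K J j / 36)))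
        ≤ A + B * (ind (ω ∉ S) + δ) + B * (4 * ((1 / 2) ^ K * (2 ^ j / 2 ^ J))) := by
          gcongr
          exact exp_neg_reps_div_le K (by omega)
      _ = _ := by rw [hδ]; ring

/-! ### Collecting the phases -/

section

variable {ι : Type*}

/-- Some phase of `S` is close to none of the relative phases, which are indexed by `ι`. -/
def Spurious (near : ℝ → ι → Prop) (S : Finset ℝ) : Prop := ∃ z ∈ S, ∀ b, ¬near z b

/-- No phase of `S` is close to the relative phase with index `b`. -/
def Missed (near : ℝ → ι → Prop) (S : Finset ℝ) (b : ι) : Prop := ∀ z ∈ S, ¬near z b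

theorem Spurious.or_not_near_of_insert {near : ℝ → ι → Prop} {S : Finset ℝ} {z : ℝ}
    (h : Spurious near (insert z S)) (b : ι) : Spurious near S ∨ ¬near z b := by
  obtain ⟨z', hz', hfar⟩ := h
  rcases Finset.mem_insert.mp hz' with rfl | hz'
  · exact .inr (hfar b)
  · exact .inl ⟨z', hz', hfar⟩

theorem Missed.of_insert {near : ℝ → ι → Prop} {S : Finset ℝ} {z : ℝ} {b : ι}
    (h : Missed near (insert z S) b) : Missed near S b :=
  fun z' hz' => h z' (Finset.mem_insert_of_mem hz')

variable [Fintype ι]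

/-- The probability that a uniformly random element of `ι` differs from a given one. -/
def avoidProb (ι : Type*) [Fintype ι] : ℝ := 1 - 1 / Fintype.card ι

theorem avoidProb_nonneg : 0 ≤ avoidProb ι := by
  rw [avoidProb, sub_nonneg, one_div]
  exact Nat.cast_inv_le_one _

theorem avoidProb_le_one : avoidProb ι ≤ 1 :=
  sub_le_self _ (by positivity)

theorem avoidProb_pow_card_le [Nonempty ι] : avoidProb ι ^ Fintype.card ι ≤ 1 / 2 :=
  calc _ ≤ Real.exp (-1) :=
        Real.one_sub_div_pow_le_exp_neg (mod_cast Fintype.card_pos)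
    _ ≤ 1 / 2 := by
      rw [Real.exp_neg, one_div, inv_le_inv₀ (Real.exp_pos 1) two_pos]
      linarith [Real.add_one_le_exp 1]

/-- A bound for the probability of a wrong output when `n` random eigenvectors remain to be
examined, each with error probability `η`, and `S` is the set of phases found so far: either `S` is
already spoiled, or one of the estimates fails, or a phase missed by `S` is not drawn again. -/
def risk (near : ℝ → ι → Prop) (η : ℝ) (n : ℕ) (S : Finset ℝ) : ℝ :=
  ind (Spurious near S) + n * η + ∑ b, ind (Missed near S b) * avoidProb ι ^ n

theorem ind_spurious_or_missed_le_risk (near : ℝ → ι → Prop) (η : ℝ) (S : Finset ℝ) :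
    ind (Spurious near S ∨ ∃ b, Missed near S b) ≤ risk near η 0 S := by
  simp only [risk, CharP.cast_eq_zero, zero_mul, add_zero, pow_zero, mul_one]
  exact (ind_or_le _ _).trans (add_le_add_right (ind_exists_le_sum _) _)

theorem risk_empty (near : ℝ → ι → Prop) (η : ℝ) (n : ℕ) :
    risk near η n ∅ = n * η + Fintype.card ι * avoidProb ι ^ n := by
  simp [risk, Spurious, Missed, ind]

theorem risk_insert_le (near : ℝ → ι → Prop) (η : ℝ) (n : ℕ) (S : Finset ℝ) (z : ℝ) (b : ι) :
    risk near η n (insert z S) ≤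
      risk near η n S - ind (Missed near S b) * avoidProb ι ^ n + 2 * ind (¬near z b) := by
  classical
  have hr₀ : 0 ≤ avoidProb ι ^ n := pow_nonneg avoidProb_nonneg n
  have hr₁ : avoidProb ι ^ n ≤ 1 := pow_le_one₀ avoidProb_nonneg avoidProb_le_one
  have hspurious : ind (Spurious near (insert z S)) ≤ ind (Spurious near S) + ind (¬near z b) :=
    (ind_mono fun h => h.or_not_near_of_insert b).trans (ind_or_le _ _)
  have hdrawn : ind (Missed near (insert z S) b) * avoidProb ι ^ n ≤ ind (¬near z b) :=
    calc _ ≤ ind (Missed near (insert z S) b) := mul_le_of_le_one_right (ind_nonneg _) hr₁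
      _ ≤ _ := ind_mono fun h => h z (Finset.mem_insert_self z S)
  have hothers : ∑ b' ∈ Finset.univ.erase b, ind (Missed near (insert z S) b') * avoidProb ι ^ n ≤
      ∑ b' ∈ Finset.univ.erase b, ind (Missed near S b') * avoidProb ι ^ n :=
    Finset.sum_le_sum fun b' _ => mul_le_mul_of_nonneg_right (ind_mono Missed.of_insert) hr₀
  rw [risk, risk, ← Finset.add_sum_erase _ _ (Finset.mem_univ b),
    ← Finset.add_sum_erase (a := b) _ _ (Finset.mem_univ b)]
  linarith

theorem sum_risk_sub_div_card [Nonempty ι] (near : ℝ → ι → Prop) (η : ℝ) (n : ℕ) (S : Finset ℝ) :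
    (∑ b, (risk near η n S - ind (Missed near S b) * avoidProb ι ^ n + η)) / Fintype.card ι =
      risk near η (n + 1) S := by
  have hcard : (Fintype.card ι : ℝ) ≠ 0 := Nat.cast_ne_zero.mpr Fintype.card_ne_zero
  simp only [Finset.sum_add_distrib, Finset.sum_sub_distrib, Finset.sum_const, Finset.card_univ,
    nsmul_eq_mul, ← Finset.sum_mul, risk]
  rw [pow_succ, show avoidProb ι = 1 - 1 / Fintype.card ι from rfl]
  push_cast
  field_simp
  ring

end

/-- An element of `S` in `[0, 2π)`, if there is any, and `0` otherwise. -/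
def pick (S : Set ℝ) : ℝ :=
  open Classical in if h : (S ∩ Set.Ico 0 (2 * Real.pi)).Nonempty then h.some else 0

theorem pick_mem_Ico (S : Set ℝ) : pick S ∈ Set.Ico 0 (2 * Real.pi) := by
  rw [pick]
  split_ifs with h
  · exact h.some_mem.2
  · exact ⟨le_rfl, Real.two_pi_pos⟩

theorem pick_mem {S : Set ℝ} {x : ℝ} (hx : x ∈ S) (hx' : x ∈ Set.Ico 0 (2 * Real.pi)) :
    pick S ∈ S := by
  have h : (S ∩ Set.Ico 0 (2 * Real.pi)).Nonempty := ⟨x, hx, hx'⟩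
  rw [pick, dif_pos h]
  exact h.some_mem.1

/-- The finite sets of phases in `[0, 2π)`, which are the possible outputs of an algorithm. -/
abbrev PhaseSet : Type := {S : Finset ℝ // (S : Set ℝ) ⊆ Set.Ico 0 (2 * Real.pi)}

/-- Add an element of `A` to the phases found so far. -/
def PhaseSet.insertPick (S : PhaseSet) (A : Set ℝ) : PhaseSet :=
  ⟨insert (pick A) S.1, by
    rw [Finset.coe_insert]
    exact Set.insert_subset (pick_mem_Ico A) S.2⟩

section

variable {m : ℕ} {Z : Matrix (Fin (m + 1)) (Fin (m + 1)) ℂ} {E : Finset ℝ → Prop}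
  {u w : Fin (m + 1) → ℂ}

theorem probLE_refresh_first (hu : star u ⬝ᵥ u = 1) (V : Matrix.unitaryGroup (Fin (m + 1)) ℂ)
    {p : Algorithm (m + 1)} {c : ℝ}
    (h : ∀ a, ProbLE Z E ((V : Matrix (Fin (m + 1)) (Fin (m + 1)) ℂ).col a) w p c) :
    ProbLE Z E u w (refresh .first (Equiv.refl (Fin (m + 1))) p) c := by
  intro β
  rw [prodState, prodVec_eq_tensorAt_first,
    probFrom_refresh (r := .first) _ p Z E hu (fun _ _ => rfl) V, div_le_iff₀ (by positivity)]
  calc _ ≤ ∑ _a : Fin (m + 1), c := Finset.sum_le_sum fun a _ => by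
        have := h a β
        rwa [prodState, prodVec_eq_tensorAt_first] at this
    _ = _ := by simp [mul_comm]

theorem probLE_refresh_second (hw : star w ⬝ᵥ w = 1) (V : Matrix.unitaryGroup (Fin (m + 1)) ℂ)
    {p : Algorithm (m + 1)} {c : Fin (m + 1) → ℝ}
    (h : ∀ b, ProbLE Z E u ((V : Matrix (Fin (m + 1)) (Fin (m + 1)) ℂ).col b) p (c b)) :
    ProbLE Z E u w (refresh .second (Equiv.refl (Fin (m + 1))) p) ((∑ b, c b) / (m + 1 : ℝ)) := by
  intro β
  rw [prodState, prodVec_eq_tensorAt_second,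
    probFrom_refresh (r := .second) _ p Z E hw (fun _ _ => rfl) V]
  gcongr with b
  have := h b β
  rwa [prodState, prodVec_eq_tensorAt_second] at this

theorem trace_prodState (hu : star u ⬝ᵥ u = 1) (hw : star w ⬝ᵥ w = 1) (b : Bool) :
    (prodState u w b).trace = 1 := by
  have hqubit (i j) : ∑ q : Bool, prodState u w b (i, j, q) (i, j, q) =
      (star (u i) * u i) * (star (w j) * w j) := by
    rw [Fintype.sum_bool]
    cases b <;> simp [prodState, pureState, Matrix.vecMulVec_apply, prodVec] <;> ring
  calc (prodState u w b).trace
      = (star u ⬝ᵥ u) * (star w ⬝ᵥ w) := by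
        simp only [Matrix.trace, Matrix.diag_apply, Fintype.sum_prod_type, hqubit, dotProduct,
          Finset.sum_mul_sum, Pi.star_apply]
    _ = 1 := by rw [hu, hw, one_mul]

/-- Estimate `n` times the phase of a random eigenvalue relative to the eigenvalue of the
eigenvector in the first qudit. -/
def runs (K J : ℕ) : ℕ → PhaseSet → Algorithm (m + 1)
  | 0, S => .output S.1 S.2
  | n + 1, S => refresh .second (Equiv.refl (Fin (m + 1))) <|
      estimate K J (J + 1) (Set.Ico 0 (2 * Real.pi)) fun A => runs K J n (S.insertPick A)

theorem probLE_runs {V : Matrix.unitaryGroup (Fin (m + 1)) ℂ} {ω : Fin (m + 1) → ℝ}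
    (hu : star u ⬝ᵥ u = 1)
    (hω : ∀ b, IsEigenpair Z u ((V : Matrix (Fin (m + 1)) (Fin (m + 1)) ℂ).col b) (ω b))
    (hω_mem : ∀ b, ω b ∈ Set.Ico 0 (2 * Real.pi)) {K J : ℕ} (hK : 0 < K)
    {near : ℝ → Fin (m + 1) → Prop}
    (hnear : ∀ z b, ‖((z - ω b : ℝ) : AddCircle (2 * Real.pi))‖ ≤ Real.pi / 3 / 2 ^ J → near z b)
    (hE : ∀ S, E S → Spurious near S ∨ ∃ b, Missed near S b)
    (n : ℕ) (S : PhaseSet) (hw : star w ⬝ᵥ w = 1) :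
    ProbLE Z E u w (runs K J n S) (risk near (16 * (1 / 2) ^ K) n S.1) := by
  set η : ℝ := 16 * (1 / 2) ^ K with hη
  induction n generalizing S w with
  | zero =>
    intro β
    rw [runs, Algorithm.probFrom, trace_prodState hu hw]
    exact (ind_mono (hE S.1)).trans (ind_spurious_or_missed_le_risk near η S.1)
  | succ n ih =>
    rw [← sum_risk_sub_div_card, Fintype.card_fin, Nat.cast_succ]
    refine probLE_refresh_second hw V fun b => ?_
    set R := risk near η n S.1 - ind (Missed near S.1 b) * avoidProb (Fin (m + 1)) ^ n
    have hrest (A : Set ℝ) (hA : IsResolved (J + 1) A) :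
        ProbLE Z E u ((V : Matrix (Fin (m + 1)) (Fin (m + 1)) ℂ).col b)
          (runs K J n (S.insertPick A)) (R + 2 * ind (ω b ∉ A)) := by
      refine (ih (S.insertPick A) (star_col_dotProduct_col V b)).mono
        ((risk_insert_le near η n S.1 (pick A) b).trans ?_)
      gcongr
      exact ind_mono fun hfar hωA =>
        hfar <| hnear _ b <| hA.norm_coe_sub_le (pick_mem hωA (hω_mem b)) hωA
    refine ((hω b).probLE_estimate hK zero_le_two le_rfl fun A _ => hrest A).mono (le_of_eq ?_)
    have hin : ind (ω b ∉ Set.Ico 0 (2 * Real.pi)) = 0 := if_neg (not_not.mpr (hω_mem b))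
    rw [hin, hη, pow_succ (2 : ℝ)]
    field_simp
    ring

end

/-! ### Costs -/

/-- Bounds for the four costs of an algorithm: the number of queries, the number of elementary
operations, and those in the current run and in any one run. -/
structure CostLE (p : Algorithm d) (q g c G : ℕ) : Prop where
  queries : p.queries ≤ q
  gates : p.gates ≤ g
  currentRun : p.currentRun ≤ c
  gatesPerRun : p.gatesPerRun ≤ G

/-- The number of elementary operations in a Hadamard test. -/
def testGates (d : ℕ) : ℕ := 14 * quditBits d + 4

theorem length_cswapOp_circuit (d : ℕ) : (cswapOp d).circuit.length = 7 * quditBits d := by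
  rw [cswapOp, length_cswapCircuit, List.length_finRange]

theorem length_qubitOp_circuit (U : Matrix.unitaryGroup Bool ℂ) :
    (qubitOp d U).circuit.length = 1 := rfl

namespace CostLE

section

variable {q g c G : ℕ} {p : Algorithm d}

theorem mono (h : CostLE p q g c G) {q' g' c' : ℕ} (hq : q ≤ q') (hg : g ≤ g') (hc : c ≤ c') :
    CostLE p q' g' c' G :=
  ⟨h.queries.trans hq, h.gates.trans hg, h.currentRun.trans hc, h.gatesPerRun⟩

theorem query (h : CostLE p q g c G) : CostLE (.query p) (q + 1) g c G where
  queries := Nat.succ_le_succ h.queries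
  gates := h.gates
  currentRun := h.currentRun
  gatesPerRun := h.gatesPerRun

theorem queryPow (h : CostLE p q g c G) (t : ℕ) : CostLE (queryPow t p) (q + t) g c G := by
  induction t with
  | zero => exact h
  | succ t ih => exact ih.query

theorem apply (h : CostLE p q g c G) (V : GateOp d) (hG : c + V.circuit.length ≤ G) :
    CostLE (.apply V p) q (g + V.circuit.length) (c + V.circuit.length) G where
  queries := h.queries
  gates := Nat.add_le_add_right h.gates _
  currentRun := Nat.add_le_add_right h.currentRun _
  gatesPerRun := max_le ((Nat.add_le_add_right h.currentRun _).trans hG) h.gatesPerRun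

theorem prepare_first (h : CostLE p q g c G) (l : Level d .first) (hG : c + quditBits d ≤ G) :
    CostLE (.prepare .first l p) q (g + quditBits d) (c + quditBits d) G where
  queries := h.queries
  gates := Nat.add_le_add_right h.gates _
  currentRun := Nat.add_le_add_right h.currentRun _
  gatesPerRun := max_le ((Nat.add_le_add_right h.currentRun _).trans hG) h.gatesPerRun

theorem prepare_second (h : CostLE p q g c G) (l : Level d .second) (hG : quditBits d ≤ G) :
    CostLE (.prepare .second l p) q (g + quditBits d) (quditBits d) G where
  queries := h.queries
  gates := Nat.add_le_add_right h.gates _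
  currentRun := le_rfl
  gatesPerRun := max_le hG h.gatesPerRun

theorem prepare_qubit (h : CostLE p q g c G) (b : Bool) (hG : c + 1 ≤ G) :
    CostLE (.prepare .qubit b p) q (g + 1) (c + 1) G where
  queries := h.queries
  gates := Nat.add_le_add_right h.gates _
  currentRun := Nat.add_le_add_right h.currentRun _
  gatesPerRun := max_le ((Nat.add_le_add_right h.currentRun _).trans hG) h.gatesPerRun

theorem measure {r : Register} {next : Level d r → Algorithm d}
    (h : ∀ l, CostLE (next l) q g c G) (hG : c + registerBits d r ≤ G) :
    CostLE (.measure r next) q (g + registerBits d r) (c + registerBits d r) G where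
  queries := Finset.sup_le fun l _ => (h l).queries
  gates := Nat.add_le_add_right (Finset.sup_le fun l _ => (h l).gates) _
  currentRun := Nat.add_le_add_right (Finset.sup_le fun l _ => (h l).currentRun) _
  gatesPerRun := max_le
    ((Nat.add_le_add_right (Finset.sup_le fun l _ => (h l).currentRun) _).trans hG)
    (Finset.sup_le fun l _ => (h l).gatesPerRun)

theorem random {m : ℕ} {next : Fin (m + 1) → Algorithm d} (h : ∀ i, CostLE (next i) q g c G) :
    CostLE (.random m next) q g c G where
  queries := Finset.sup_le fun i _ => (h i).queries
  gates := Finset.sup_le fun i _ => (h i).gates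
  currentRun := Finset.sup_le fun i _ => (h i).currentRun
  gatesPerRun := Finset.sup_le fun i _ => (h i).gatesPerRun

theorem hadamardTest {next : Bool → Algorithm d} (h : ∀ b, CostLE (next b) q g c G)
    (s : unitary ℂ) (t : ℕ) (hG : c + testGates d ≤ G) :
    CostLE (hadamardTest s t next) (q + t) (g + testGates d) (c + testGates d) G := by
  rw [testGates] at hG ⊢
  have hmeasure := measure (r := .qubit) h (by rw [registerBits]; omega)
  have hinterfere := hmeasure.apply (qubitOp d (hadamardUnitary s))
    (by rw [length_qubitOp_circuit, registerBits]; omega)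
  have hswapBack := hinterfere.apply (cswapOp d)
    (by rw [length_qubitOp_circuit, length_cswapOp_circuit, registerBits]; omega)
  have hswap := (hswapBack.queryPow t).apply (cswapOp d)
    (by rw [length_qubitOp_circuit, length_cswapOp_circuit, registerBits]; omega)
  have hsplit := hswap.apply (qubitOp d (hadamardUnitary 1))
    (by rw [length_qubitOp_circuit, length_qubitOp_circuit, length_cswapOp_circuit,
      registerBits]; omega)
  simp only [length_qubitOp_circuit, length_cswapOp_circuit, registerBits] at hsplit
  exact (hsplit.prepare_qubit false (by omega)).mono le_rfl (by omega) (by omega)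

theorem repeatTest {next : ℝ → Algorithm d} (h : ∀ n, CostLE (next n) q g c G)
    (s : unitary ℂ) (t m : ℕ) (hG : c + m * testGates d ≤ G) (n : ℝ) :
    CostLE (repeatTest s t m n next) (q + m * t) (g + m * testGates d)
      (c + m * testGates d) G := by
  induction m generalizing n with
  | zero => simpa [EigenphaseEstimation.repeatTest] using h n
  | succ m ih =>
    simp only [Nat.succ_mul, ← Nat.add_assoc] at hG ⊢
    exact hadamardTest (fun b => ih (by omega) (n + sign b)) s t hG

theorem measurePhase {next : Set ℝ → Algorithm d} (h : ∀ S, CostLE (next S) q g c G) (m t : ℕ)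
    (hG : c + 2 * m * testGates d ≤ G) :
    CostLE (measurePhase m t next) (q + 2 * m * t) (g + 2 * m * testGates d)
      (c + 2 * m * testGates d) G := by
  simp only [two_mul, Nat.add_mul, ← Nat.add_assoc] at hG ⊢
  exact repeatTest (fun a => repeatTest (fun a' => h (consistentPhases m t a a')) negI t m
    (by omega) 0) 1 t m hG 0

theorem estimate {next : Set ℝ → Algorithm d} (h : ∀ S, CostLE (next S) q g c G) (K J j : ℕ)
    (hG : c + (∑ i ∈ Finset.range j, 2 * reps K J i) * testGates d ≤ G) (S : Set ℝ) :
    CostLE (estimate K J j S next) (q + ∑ i ∈ Finset.range j, 2 * reps K J i * 2 ^ i)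
      (g + (∑ i ∈ Finset.range j, 2 * reps K J i) * testGates d)
      (c + (∑ i ∈ Finset.range j, 2 * reps K J i) * testGates d) G := by
  induction j generalizing S with
  | zero => simpa [EigenphaseEstimation.estimate] using h S
  | succ j ih =>
    simp only [Finset.sum_range_succ, Nat.add_mul, ← Nat.add_assoc] at hG ⊢
    exact measurePhase (fun C => ih (by omega) (S ∩ C)) (reps K J j) (2 ^ j) hG

end

theorem runs {m K J Q R : ℕ}
    (hQ : ∑ j ∈ Finset.range (J + 1), 2 * reps K J j * 2 ^ j ≤ Q)
    (hR : (∑ j ∈ Finset.range (J + 1), 2 * reps K J j) * testGates (m + 1) ≤ R)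
    (n : ℕ) (S : PhaseSet) :
    CostLE (runs (m := m) K J n S) (n * Q) (n * (R + quditBits (m + 1))) (quditBits (m + 1))
      (R + 2 * quditBits (m + 1)) := by
  induction n generalizing S with
  | zero => exact ⟨Nat.zero_le _, Nat.zero_le _, Nat.zero_le _, Nat.zero_le _⟩
  | succ n ih =>
    have hestimate := estimate (fun A => ih (S.insertPick A)) K J (J + 1) (by omega)
      (Set.Ico 0 (2 * Real.pi))
    refine (random fun i => hestimate.prepare_second i (by omega)).mono ?_ ?_ le_rfl
    · rw [Nat.succ_mul]; omega
    · rw [Nat.succ_mul]; omega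

end CostLE

/-- The number of repetitions decreases with the power of the oracle, so the total is dominated by
the largest power, which carries no factor `J`. -/
theorem sum_reps_mul_two_pow_le (K J : ℕ) {n : ℕ} (hn : n ≤ J + 1) :
    ∑ j ∈ Finset.range n, 2 * reps K J j * 2 ^ j ≤ 72 * (2 ^ n * (K + (J + 1 - n) + 1)) := by
  induction n with
  | zero => simp
  | succ n ih =>
    obtain ⟨a, rfl⟩ : ∃ a, J = n + a := ⟨J - n, by omega⟩
    have hprev := ih (by omega)
    rw [show n + a + 1 - n = a + 1 by omega] at hprev
    rw [Finset.sum_range_succ, reps, show n + a + 1 - (n + 1) = a by omega, Nat.add_sub_cancel_left,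
      pow_succ]
    linarith

theorem sum_reps_le (K J : ℕ) :
    ∑ j ∈ Finset.range (J + 1), 2 * reps K J j ≤ 72 * ((J + 1) * (K + J)) :=
  calc _ ≤ ∑ _j ∈ Finset.range (J + 1), 72 * (K + J) := by
        refine Finset.sum_le_sum fun j _ => ?_
        rw [reps]; omega
    _ = _ := by rw [Finset.sum_const, Finset.card_range, smul_eq_mul, Nat.mul_left_comm]

/-! ### The precision of the output -/

instance : Fact (0 < 2 * Real.pi) := ⟨Real.two_pi_pos⟩

theorem shiftHausdorff_le_of_dist_le {A B : Set ℝ} (τ : ℝ) {ε : ℝ}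
    (hAB : ∀ x ∈ A, ∃ y ∈ B, ‖((y - (x + τ) : ℝ) : AddCircle (2 * Real.pi))‖ ≤ ε)
    (hBA : ∀ y ∈ B, ∃ x ∈ A, ‖((y - (x + τ) : ℝ) : AddCircle (2 * Real.pi))‖ ≤ ε) :
    shiftHausdorff A B ≤ ENNReal.ofReal ε := by
  set τ' := AddCircle.equivIco (2 * Real.pi) 0 τ with hτ'
  have hmem : (τ' : ℝ) ∈ Set.Ico 0 (2 * Real.pi) := by simpa only [zero_add] using τ'.2
  have hedist (x y : ℝ) (h : ‖((y - (x + τ) : ℝ) : AddCircle (2 * Real.pi))‖ ≤ ε) :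
      edist ((x + τ' : ℝ) : AddCircle (2 * Real.pi)) ((y + 0 : ℝ) : AddCircle (2 * Real.pi)) ≤
        ENNReal.ofReal ε := by
    rw [edist_dist, AddCircle.coe_add, hτ', AddCircle.coe_equivIco, ← AddCircle.coe_add, add_zero,
      dist_comm, dist_eq_norm, ← AddCircle.coe_sub]
    exact ENNReal.ofReal_le_ofReal h
  refine iInf₂_le_of_le (τ' : ℝ) hmem (Metric.hausdorffEDist_le_of_mem_edist ?_ ?_)
  · rintro _ ⟨x, hx, rfl⟩
    obtain ⟨y, hy, hxy⟩ := hAB x hx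
    exact ⟨_, ⟨y, hy, rfl⟩, hedist x y hxy⟩
  · rintro _ ⟨y, hy, rfl⟩
    obtain ⟨x, hx, hxy⟩ := hBA y hy
    exact ⟨_, ⟨x, hx, rfl⟩, (edist_comm _ _).trans_le (hedist x y hxy)⟩

theorem shiftHausdorff_le_of_pi_le {A B : Set ℝ} (hA : A.Nonempty) (hB : B.Nonempty) {ε : ℝ}
    (hε : Real.pi ≤ ε) : shiftHausdorff A B ≤ ENNReal.ofReal ε := by
  have hnorm (x : AddCircle (2 * Real.pi)) : ‖x‖ ≤ ε := by
    refine (AddCircle.norm_le_half_period _ Real.two_pi_pos.ne').trans ?_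
    rwa [abs_of_pos Real.two_pi_pos, mul_div_cancel_left₀ _ two_ne_zero]
  obtain ⟨x, hx⟩ := hA
  obtain ⟨y, hy⟩ := hB
  exact shiftHausdorff_le_of_dist_le 0 (fun _ _ => ⟨y, hy, hnorm _⟩) fun _ _ => ⟨x, hx, hnorm _⟩

/-- The eigenphase `θ b`, relative to the eigenphase `θ a`, as an angle in `[0, 2π)`. -/
def relPhase (θ : Fin d → ℝ) (a b : Fin d) : ℝ :=
  AddCircle.equivIco (2 * Real.pi) 0 (θ b - θ a : ℝ)

theorem relPhase_mem_Ico (θ : Fin d → ℝ) (a b : Fin d) :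
    relPhase θ a b ∈ Set.Ico 0 (2 * Real.pi) := by
  simpa only [relPhase, zero_add] using (AddCircle.equivIco (2 * Real.pi) 0 (θ b - θ a : ℝ)).2

theorem coe_relPhase (θ : Fin d → ℝ) (a b : Fin d) :
    (relPhase θ a b : AddCircle (2 * Real.pi)) = (θ b - θ a : ℝ) :=
  AddCircle.coe_equivIco

section

variable {Z : Matrix (Fin d) (Fin d) ℂ} {V : Matrix.unitaryGroup (Fin d) ℂ} {θ : Fin d → ℝ}

theorem IsEigenframe.isEigenpair (h : IsEigenframe Z V θ) (a b : Fin d) :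
    IsEigenpair Z ((V : Matrix (Fin d) (Fin d) ℂ).col a) ((V : Matrix (Fin d) (Fin d) ℂ).col b)
      (relPhase θ a b) := by
  refine ⟨Complex.exp (θ a * Complex.I), Complex.norm_exp_ofReal_mul_I _, h.mulVec_col a, ?_⟩
  obtain ⟨n, hn⟩ := (AddCircle.coe_eq_zero_iff (p := 2 * Real.pi)).mp
    (show ((relPhase θ a b - (θ b - θ a) : ℝ) : AddCircle (2 * Real.pi)) = 0 by
      rw [AddCircle.coe_sub, coe_relPhase, sub_self])
  rw [h.mulVec_col b, ← Complex.exp_add]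
  congr 1
  refine Complex.exp_eq_exp_iff_exists_int.mpr ⟨-n, ?_⟩
  have hcast : (n : ℂ) * (2 * Real.pi) = relPhase θ a b - (θ b - θ a) := by
    exact_mod_cast (zsmul_eq_mul _ _).symm.trans hn
  push_cast
  linear_combination Complex.I * hcast

theorem IsEigenframe.shiftHausdorff_le (h : IsEigenframe Z V θ) (a : Fin d) {S : Set ℝ} {ε : ℝ}
    (hsound : ∀ z ∈ S, ∃ b, ‖((z - relPhase θ a b : ℝ) : AddCircle (2 * Real.pi))‖ ≤ ε)
    (hcomplete : ∀ b, ∃ z ∈ S, ‖((z - relPhase θ a b : ℝ) : AddCircle (2 * Real.pi))‖ ≤ ε) :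
    shiftHausdorff (eigenphases Z) S ≤ ENNReal.ofReal ε := by
  have hcoe (z b) : ((z - relPhase θ a b : ℝ) : AddCircle (2 * Real.pi)) =
      (z - (θ b + -θ a) : ℝ) := by
    rw [AddCircle.coe_sub, coe_relPhase, ← AddCircle.coe_sub, sub_eq_add_neg (θ b)]
  simp only [hcoe] at hsound hcomplete
  rw [h.eigenphases_eq_range]
  exact shiftHausdorff_le_of_dist_le (-θ a) (Set.forall_mem_range.mpr hcomplete)
    fun z hz => Set.exists_range_iff.mpr (hsound z hz)

end

/-! ### The algorithm -/

/-- The number of binary digits of the phases which are estimated for precision `ε`. -/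
def precisionBits (ε : ℝ) : ℕ := Nat.clog 2 ⌈4 / ε⌉₊

/-- The set that contains only the phase `0`. -/
def zeroPhase : PhaseSet := ⟨{0}, by simp [Real.pi_pos]⟩

/-- The estimation of the eigenphases up to a global shift. In dimension `1`, and also if `ε` is at
least the diameter of the circle, there is nothing to estimate. -/
def eigenphaseAlgorithm : (d : ℕ) → ℝ → Algorithm d
  | 0, _ => .output zeroPhase.1 zeroPhase.2
  | m + 1, ε =>
    open Classical in
    if m = 0 ∨ 4 ≤ ε then .output zeroPhase.1 zeroPhase.2
    else refresh .first (Equiv.refl (Fin (m + 1))) <|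
      runs (114 * quditBits (m + 1)) (precisionBits ε) (102 * (m + 1) * quditBits (m + 1))
        ⟨∅, by simp⟩

theorem four_div_le_two_pow_precisionBits (ε : ℝ) : 4 / ε ≤ 2 ^ precisionBits ε :=
  (Nat.le_ceil _).trans (mod_cast Nat.le_pow_clog one_lt_two _)

theorem two_pow_precisionBits_le {ε : ℝ} (h₀ : 0 < ε) (h₄ : ε < 4) :
    (2 : ℝ) ^ precisionBits ε ≤ 16 / ε := by
  have hone : 1 < 4 / ε := by rwa [one_lt_div h₀]
  have hceil : 1 < ⌈4 / ε⌉₊ := by rwa [Nat.lt_ceil, Nat.cast_one]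
  have hpos : precisionBits ε ≠ 0 := (Nat.clog_pos one_lt_two hceil).ne'
  have hpred : (2 : ℝ) ^ (precisionBits ε - 1) < ⌈4 / ε⌉₊ :=
    mod_cast Nat.pow_pred_clog_lt_self one_lt_two hceil
  calc (2 : ℝ) ^ precisionBits ε = 2 * 2 ^ (precisionBits ε - 1) := (mul_pow_sub_one hpos 2).symm
    _ ≤ 2 * (4 / ε + 1) := by linarith [Nat.ceil_lt_add_one (zero_le_one.trans hone.le)]
    _ ≤ 2 * (4 / ε + 4 / ε) := by gcongr
    _ = 16 / ε := by ring

/-! ### The probability of failure -/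

theorem natCast_mul_half_pow_le_one {n L : ℕ} (h : n ≤ 2 ^ L) : n * (1 / 2 : ℝ) ^ L ≤ 1 := by
  rw [one_div_pow, mul_one_div]
  exact div_le_one_of_le₀ (mod_cast h) (by positivity)

theorem estimation_failure_le {d L : ℕ} (hL : 0 < L) (hdL : d ≤ 2 ^ L) :
    ((102 * d * L : ℕ) : ℝ) * (16 * (1 / 2) ^ (114 * L)) ≤ ((1 / 2) ^ L) ^ 101 := by
  set y : ℝ := (1 / 2) ^ L with hy
  have hy_half : y ≤ 1 / 2 := pow_le_of_le_one (by norm_num) (by norm_num) hL.ne'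
  have hdy : d * y ≤ 1 := natCast_mul_half_pow_le_one hdL
  have hLy : L * y ≤ 1 := natCast_mul_half_pow_le_one Nat.lt_two_pow_self.le
  calc _ = 1632 * y ^ 11 * ((d * y) * (L * y)) * y ^ 101 := by
        rw [mul_comm 114 L, pow_mul, ← hy]
        push_cast
        ring
    _ ≤ 1632 * (1 / 2) ^ 11 * (1 * 1) * y ^ 101 := by gcongr
    _ ≤ y ^ 101 := mul_le_of_le_one_left (by positivity) (by norm_num)

theorem missing_failure_le {d L : ℕ} (hdL : d ≤ 2 ^ L) {r : ℝ} (hr : 0 ≤ r)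
    (hrd : r ^ d ≤ 1 / 2) : d * r ^ (102 * d * L) ≤ ((1 / 2) ^ L) ^ 101 :=
  calc d * r ^ (102 * d * L) = d * (r ^ d) ^ (L * 102) := by
        rw [← pow_mul]
        congr 2
        ring
    _ ≤ d * (1 / 2) ^ (L * 102) := by gcongr
    _ = (d * (1 / 2) ^ L) * ((1 / 2) ^ L) ^ 101 := by rw [pow_mul]; ring
    _ ≤ ((1 / 2) ^ L) ^ 101 :=
      mul_le_of_le_one_left (by positivity) (natCast_mul_half_pow_le_one hdL)

theorem failure_le {d L : ℕ} (hd : 0 < d) (hL : 0 < L) (hdL : d ≤ 2 ^ L) {r : ℝ} (hr : 0 ≤ r)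
    (hrd : r ^ d ≤ 1 / 2) :
    ((102 * d * L : ℕ) : ℝ) * (16 * (1 / 2) ^ (114 * L)) + d * r ^ (102 * d * L) ≤
      ((d : ℝ) ^ 100)⁻¹ := by
  set y : ℝ := (1 / 2) ^ L
  have hy_half : y ≤ 1 / 2 := pow_le_of_le_one (by norm_num) (by norm_num) hL.ne'
  have hyd : y ≤ (d : ℝ)⁻¹ := by
    rw [inv_eq_one_div, le_div_iff₀' (mod_cast hd)]
    exact natCast_mul_half_pow_le_one hdL
  calc _ ≤ y ^ 101 + y ^ 101 :=
        add_le_add (estimation_failure_le hL hdL) (missing_failure_le hdL hr hrd)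
    _ = 2 * y * y ^ 100 := by ring
    _ ≤ y ^ 100 := mul_le_of_le_one_left (by positivity) (by linarith)
    _ ≤ (d : ℝ)⁻¹ ^ 100 := by gcongr
    _ = ((d : ℝ) ^ 100)⁻¹ := inv_pow _ _

theorem initialState_eq_prodState (m : ℕ) :
    initialState (m + 1) = prodState (Pi.single 0 1) (Pi.single 0 1) false := by
  ext ⟨i, j, b⟩ ⟨i', j', b'⟩
  simp only [initialState, prodState, pureState, prodVec, Matrix.of_apply, Matrix.vecMulVec_apply,
    Pi.star_apply, Pi.single_apply, Fin.val_eq_zero_iff]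
  split_ifs <;> simp_all

theorem star_single_dotProduct_single {ι R : Type*} [Fintype ι] [DecidableEq ι] [Semiring R]
    [StarRing R] (i : ι) : star (Pi.single i (1 : R)) ⬝ᵥ Pi.single i 1 = 1 := by
  simp

theorem prob_output {m : ℕ} {S : Finset ℝ} (hS : (S : Set ℝ) ⊆ Set.Ico 0 (2 * Real.pi))
    (Z : Matrix (Fin (m + 1)) (Fin (m + 1)) ℂ) (E : Finset ℝ → Prop) :
    (Algorithm.output S hS).prob Z E = ind (E S) := by
  have htrace := star_single_dotProduct_single (R := ℂ) (0 : Fin (m + 1))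
  rw [Algorithm.prob, Algorithm.probFrom, initialState_eq_prodState, trace_prodState htrace htrace,
    Complex.one_re, ind]

/-- The event that the output is not within `ε` of the eigenphases. -/
def Inaccurate (Z : Matrix (Fin d) (Fin d) ℂ) (ε : ℝ) (S : Finset ℝ) : Prop :=
  ¬shiftHausdorff (eigenphases Z) S ≤ ENNReal.ofReal ε

theorem IsEigenframe.spurious_or_missed_of_inaccurate {Z : Matrix (Fin d) (Fin d) ℂ}
    {V : Matrix.unitaryGroup (Fin d) ℂ} {θ : Fin d → ℝ} (h : IsEigenframe Z V θ) (a : Fin d)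
    {ε : ℝ} {S : Finset ℝ} (hS : Inaccurate Z ε S) :
    Spurious (fun z b => ‖((z - relPhase θ a b : ℝ) : AddCircle (2 * Real.pi))‖ ≤ ε) S ∨
      ∃ b, Missed (fun z b => ‖((z - relPhase θ a b : ℝ) : AddCircle (2 * Real.pi))‖ ≤ ε) S b := by
  contrapose! hS
  simp only [Spurious, Missed] at hS
  push Not at hS
  exact not_not_intro (h.shiftHausdorff_le a hS.1 hS.2)

section

variable {m : ℕ} {Z : Matrix (Fin (m + 1)) (Fin (m + 1)) ℂ}

theorem IsEigenframe.probLE_runs {V : Matrix.unitaryGroup (Fin (m + 1)) ℂ} {θ : Fin (m + 1) → ℝ}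
    (h : IsEigenframe Z V θ) (a : Fin (m + 1)) {ε : ℝ} (hε : 0 < ε) {L : ℕ} (hL : 0 < L)
    (hmL : m + 1 ≤ 2 ^ L) {w : Fin (m + 1) → ℂ} (hw : star w ⬝ᵥ w = 1) :
    ProbLE Z (Inaccurate Z ε) ((V : Matrix (Fin (m + 1)) (Fin (m + 1)) ℂ).col a) w
      (runs (114 * L) (precisionBits ε) (102 * (m + 1) * L) ⟨∅, by simp⟩)
      (((m + 1 : ℕ) : ℝ) ^ 100)⁻¹ := by
  have hprec : Real.pi / 3 / 2 ^ precisionBits ε ≤ ε := by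
    have hpow := four_div_le_two_pow_precisionBits ε
    rw [div_le_iff₀ hε] at hpow
    rw [div_le_iff₀ (by positivity)]
    linarith [Real.pi_le_four]
  refine (EigenphaseEstimation.probLE_runs (star_col_dotProduct_col V a) (h.isEigenpair a)
    (relPhase_mem_Ico θ a) (by omega) (fun _ _ hz => hz.trans hprec)
    (fun _ => h.spurious_or_missed_of_inaccurate a) _ _ hw).mono ?_
  have hcard := avoidProb_pow_card_le (ι := Fin (m + 1))
  rw [risk_empty]
  rw [Fintype.card_fin] at hcard ⊢
  exact failure_le m.succ_pos hL hmL avoidProb_nonneg hcard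

theorem prob_output_zeroPhase_le (hZ : Z ∈ Matrix.unitaryGroup (Fin (m + 1)) ℂ) {ε : ℝ}
    (h : m = 0 ∨ 4 ≤ ε) :
    (Algorithm.output zeroPhase.1 zeroPhase.2).prob Z (Inaccurate Z ε) ≤
      (((m + 1 : ℕ) : ℝ) ^ 100)⁻¹ := by
  rw [prob_output]
  rcases h with rfl | hε
  · simpa using ind_le_one _
  · obtain ⟨V, θ, hV⟩ := exists_isEigenframe hZ
    have hphases : (eigenphases Z).Nonempty := by
      rw [hV.eigenphases_eq_range]
      exact Set.range_nonempty θ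
    have haccurate : ¬Inaccurate Z ε zeroPhase.1 := not_not_intro <|
      shiftHausdorff_le_of_pi_le hphases ⟨0, by simp [zeroPhase]⟩ (Real.pi_le_four.trans hε)
    rw [ind, if_neg haccurate]
    positivity

end

theorem prob_eigenphaseAlgorithm_le (hd : 1 ≤ d) {ε : ℝ} (hε : 0 < ε)
    {Z : Matrix (Fin d) (Fin d) ℂ} (hZ : Z ∈ Matrix.unitaryGroup (Fin d) ℂ) :
    (eigenphaseAlgorithm d ε).prob Z (Inaccurate Z ε) ≤ ((d : ℝ) ^ 100)⁻¹ := by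
  obtain ⟨m, rfl⟩ := Nat.exists_eq_add_of_le' hd
  rw [eigenphaseAlgorithm]
  split_ifs with hcase
  · exact prob_output_zeroPhase_le hZ hcase
  · obtain ⟨V, θ, hV⟩ := exists_isEigenframe hZ
    have hzero := star_single_dotProduct_single (R := ℂ) (0 : Fin (m + 1))
    have hruns := fun a => hV.probLE_runs a hε (Nat.clog_pos one_lt_two (by omega))
      (Nat.le_pow_clog one_lt_two _) hzero
    rw [Algorithm.prob, initialState_eq_prodState]
    exact probLE_refresh_first hzero V hruns false

/-! ### Bounds for the costs -/

theorem quditBits_le (hd : 1 < d) : (quditBits d : ℝ) ≤ 3 * Real.log d := by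
  have hL : 1 ≤ quditBits d := Nat.clog_pos one_lt_two hd
  have hpred : (2 : ℝ) ^ (quditBits d - 1) ≤ d :=
    mod_cast (Nat.pow_pred_clog_lt_self one_lt_two hd).le
  have hlog := Real.log_le_log (by positivity) hpred
  have hlog_two : Real.log 2 ≤ Real.log d := Real.log_le_log two_pos (mod_cast hd)
  rw [Real.log_pow, Nat.cast_sub hL, Nat.cast_one] at hlog
  nlinarith [Real.log_two_gt_d9, (Nat.cast_nonneg _ : (0 : ℝ) ≤ quditBits d)]

section

variable {ε : ℝ}

theorem one_le_log_add_two {x : ℝ} (hx : 0 ≤ x) : 1 ≤ 9 * Real.log (x + 2) := by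
  have hlog : Real.log 2 ≤ Real.log (x + 2) := Real.log_le_log two_pos (by linarith)
  linarith [Real.log_two_gt_d9]

theorem quditBits_le_log (hd : 1 < d) (h₀ : 0 < ε) (h₄ : ε < 4) :
    (quditBits d : ℝ) ≤ 9 * Real.log (d / ε + 2) := by
  set x : ℝ := d / ε + 2
  have hx₂ : 2 ≤ x := le_add_of_nonneg_left (by positivity)
  have hcube : (d : ℝ) ≤ x ^ 3 :=
    calc (d : ℝ) = ε * (d / ε) := by field_simp
      _ ≤ 2 ^ 2 * x := by gcongr <;> linarith
      _ ≤ x ^ 2 * x := by gcongr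
      _ = x ^ 3 := by ring
  have hlog := Real.log_le_log (mod_cast (by omega : 0 < d)) hcube
  rw [Real.log_pow, Nat.cast_ofNat] at hlog
  linarith [quditBits_le hd]

theorem precisionBits_le_log (hd : 1 ≤ d) (h₀ : 0 < ε) (h₄ : ε < 4) :
    (precisionBits ε : ℝ) ≤ 9 * Real.log (d / ε + 2) := by
  set x : ℝ := d / ε + 2
  have hx₂ : 2 ≤ x := le_add_of_nonneg_left (by positivity)
  have hd' : (1 : ℝ) ≤ d := mod_cast hd
  have hpow : (2 : ℝ) ^ precisionBits ε ≤ x ^ 5 :=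
    calc (2 : ℝ) ^ precisionBits ε ≤ 16 / ε := two_pow_precisionBits_le h₀ h₄
      _ = 2 ^ 2 * 2 ^ 2 * (1 / ε) := by ring
      _ ≤ 2 ^ 2 * 2 ^ 2 * (d / ε) := by gcongr
      _ ≤ x ^ 2 * x ^ 2 * x := by gcongr; linarith
      _ = x ^ 5 := by ring
  have hlog := Real.log_le_log (by positivity) hpow
  rw [Real.log_pow, Real.log_pow, Nat.cast_ofNat] at hlog
  nlinarith [Real.log_two_gt_d9, (Nat.cast_nonneg _ : (0 : ℝ) ≤ precisionBits ε)]

/-- A bound for the number of elementary operations in the Hadamard tests of one run. -/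
def runGates (d : ℕ) (ε : ℝ) : ℕ :=
  72 * ((precisionBits ε + 1) * (114 * quditBits d + precisionBits ε)) * testGates d

theorem runGates_le (hd : 1 < d) (h₀ : 0 < ε) (h₄ : ε < 4) :
    (runGates d ε : ℝ) ≤ 298080 * (9 * Real.log (d / ε + 2)) ^ 3 := by
  have hW : 1 ≤ 9 * Real.log (d / ε + 2) := one_le_log_add_two (by positivity)
  have hL := quditBits_le_log hd h₀ h₄
  have hJ := precisionBits_le_log hd.le h₀ h₄
  set W := 9 * Real.log (d / ε + 2)
  rw [runGates, testGates]
  push_cast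
  calc _ ≤ 72 * ((W + W) * (114 * W + W)) * (14 * W + 4 * W) := by
        gcongr
        linarith
    _ = 298080 * W ^ 3 := by ring

theorem costLE_eigenphaseAlgorithm {m : ℕ} (hm : m ≠ 0) (h₄ : ε < 4) :
    CostLE (eigenphaseAlgorithm (m + 1) ε)
      (102 * (m + 1) * quditBits (m + 1) *
        (72 * (2 ^ (precisionBits ε + 1) * (114 * quditBits (m + 1) + 1))))
      (102 * (m + 1) * quditBits (m + 1) *
        (runGates (m + 1) ε + quditBits (m + 1)) + quditBits (m + 1))
      (2 * quditBits (m + 1)) (runGates (m + 1) ε + 2 * quditBits (m + 1)) := by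
  have hQ := sum_reps_mul_two_pow_le (114 * quditBits (m + 1)) (precisionBits ε) le_rfl
  rw [Nat.sub_self, add_zero] at hQ
  have hR : _ ≤ runGates (m + 1) ε := Nat.mul_le_mul_right (testGates (m + 1))
    (sum_reps_le (114 * quditBits (m + 1)) (precisionBits ε))
  rw [eigenphaseAlgorithm, if_neg (by simp [hm, h₄])]
  exact (CostLE.random fun i => (CostLE.runs hQ hR _ _).prepare_first i (by omega)).mono
    le_rfl le_rfl (two_mul _).ge

theorem queries_eigenphaseAlgorithm_le (hd : 1 < d) (h₀ : 0 < ε) (h₄ : ε < 4) :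
    ((eigenphaseAlgorithm d ε).queries : ℝ) ≤ 10 ^ 12 * (d / ε) * Real.log d ^ 2 := by
  have hL₁ : (1 : ℝ) ≤ quditBits d := mod_cast Nat.clog_pos one_lt_two hd
  have hL := quditBits_le hd
  have hJ := two_pow_precisionBits_le h₀ h₄
  obtain ⟨m, rfl⟩ := Nat.exists_eq_add_of_le' hd.le
  refine (Nat.cast_le.mpr (costLE_eigenphaseAlgorithm (by omega) h₄).queries).trans ?_
  set L := quditBits (m + 1)
  set d : ℝ := ((m + 1 : ℕ) : ℝ) with hd'
  rw [Nat.cast_mul, Nat.cast_mul, Nat.cast_mul, ← hd', pow_succ]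
  push_cast
  calc (_ : ℝ) = 14688 * d * L * (2 ^ precisionBits ε * (114 * L + 1)) := by ring
    _ ≤ 14688 * d * L * (16 / ε * (114 * L + L)) := by gcongr
    _ = 27025920 * (d / ε) * L ^ 2 := by ring
    _ ≤ 27025920 * (d / ε) * (3 * Real.log d) ^ 2 := by gcongr
    _ = 243233280 * (d / ε) * Real.log d ^ 2 := by ring
    _ ≤ 10 ^ 12 * (d / ε) * Real.log d ^ 2 := by gcongr; norm_num

theorem gatesPerRun_eigenphaseAlgorithm_le (hd : 1 < d) (h₀ : 0 < ε) (h₄ : ε < 4) :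
    ((eigenphaseAlgorithm d ε).gatesPerRun : ℝ) ≤ 10 ^ 12 * Real.log (d / ε + 2) ^ 4 := by
  have hW : 1 ≤ 9 * Real.log (d / ε + 2) := one_le_log_add_two (by positivity)
  have hL := quditBits_le_log hd h₀ h₄
  have hR := runGates_le hd h₀ h₄
  obtain ⟨m, rfl⟩ := Nat.exists_eq_add_of_le' hd.le
  refine (Nat.cast_le.mpr (costLE_eigenphaseAlgorithm (by omega) h₄).gatesPerRun).trans ?_
  rw [Nat.cast_add, Nat.cast_mul, Nat.cast_ofNat]
  set W := 9 * Real.log (((m + 1 : ℕ) : ℝ) / ε + 2) with hW_def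
  calc _ ≤ 298080 * W ^ 3 + 2 * W := by gcongr
    _ ≤ 298080 * W ^ 4 + 2 * W ^ 4 := by
      gcongr
      · norm_num
      · exact le_self_pow₀ hW (by norm_num)
    _ ≤ 10 ^ 12 / 9 ^ 4 * W ^ 4 := by rw [← add_mul]; gcongr; norm_num
    _ = _ := by rw [hW_def]; ring

theorem gates_eigenphaseAlgorithm_le (hd : 1 < d) (h₀ : 0 < ε) (h₄ : ε < 4) :
    ((eigenphaseAlgorithm d ε).gates : ℝ) ≤ 10 ^ 12 * d * Real.log (d / ε + 2) ^ 4 := by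
  have hW : 1 ≤ 9 * Real.log (d / ε + 2) := one_le_log_add_two (by positivity)
  have hL := quditBits_le_log hd h₀ h₄
  have hR := runGates_le hd h₀ h₄
  have hd₁ : (1 : ℝ) ≤ d := mod_cast hd.le
  obtain ⟨m, rfl⟩ := Nat.exists_eq_add_of_le' hd.le
  refine (Nat.cast_le.mpr (costLE_eigenphaseAlgorithm (by omega) h₄).gates).trans ?_
  set d : ℝ := ((m + 1 : ℕ) : ℝ) with hd'
  rw [Nat.cast_add, Nat.cast_mul, Nat.cast_mul, Nat.cast_mul, ← hd', Nat.cast_add,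
    Nat.cast_ofNat]
  set W := 9 * Real.log (d / ε + 2) with hW_def
  calc _ ≤ 102 * d * W * (298080 * W ^ 3 + W) + 1 * W := by rw [one_mul]; gcongr
    _ ≤ 102 * d * W * (298080 * W ^ 3 + W ^ 3) + d * W ^ 4 := by
      gcongr <;> exact le_self_pow₀ hW (by norm_num)
    _ = 30404263 * d * W ^ 4 := by ring
    _ ≤ 10 ^ 12 / 9 ^ 4 * d * W ^ 4 := by gcongr; norm_num
    _ = _ := by rw [hW_def]; ring

theorem costs_eigenphaseAlgorithm_le (hd : 1 ≤ d) (hε : 0 < ε) :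
    ((eigenphaseAlgorithm d ε).queries : ℝ) ≤ 10 ^ 12 * (d / ε) * Real.log d ^ 2 ∧
      ((eigenphaseAlgorithm d ε).gatesPerRun : ℝ) ≤ 10 ^ 12 * Real.log (d / ε + 2) ^ 4 ∧
      ((eigenphaseAlgorithm d ε).gates : ℝ) ≤ 10 ^ 12 * d * Real.log (d / ε + 2) ^ 4 := by
  by_cases hcase : d = 1 ∨ 4 ≤ ε
  · obtain ⟨m, rfl⟩ := Nat.exists_eq_add_of_le' hd
    rw [eigenphaseAlgorithm, if_pos (by simpa using hcase)]
    simp only [Algorithm.queries, Algorithm.gatesPerRun, Algorithm.gates, Nat.cast_zero]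
    exact ⟨by positivity, by positivity, by positivity⟩
  · rw [not_or, not_le] at hcase
    have hd₁ : 1 < d := lt_of_le_of_ne hd (Ne.symm hcase.1)
    exact ⟨queries_eigenphaseAlgorithm_le hd₁ hε hcase.2,
      gatesPerRun_eigenphaseAlgorithm_le hd₁ hε hcase.2,
      gates_eigenphaseAlgorithm_le hd₁ hε hcase.2⟩

end

end EigenphaseEstimation

end

theorem theoremB2 :
    ∃ (C : ℝ) (k : ℕ) (alg : (d : ℕ) → ℝ → EigenphaseEstimation.Algorithm d),
      ∀ (d : ℕ) (ε : ℝ), 1 ≤ d → 0 < ε →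
        ((alg d ε).queries : ℝ) ≤ C * (d / ε) * Real.log d ^ 2 ∧
        ((alg d ε).gatesPerRun : ℝ) ≤ C * Real.log (d / ε + 2) ^ k ∧
        ((alg d ε).gates : ℝ) ≤ C * d * Real.log (d / ε + 2) ^ k ∧
        ∀ Z ∈ Matrix.unitaryGroup (Fin d) ℂ,
          (alg d ε).prob Z (fun S =>
            ¬ EigenphaseEstimation.shiftHausdorff (EigenphaseEstimation.eigenphases Z) (S : Set ℝ)
              ≤ ENNReal.ofReal ε) ≤ ((d : ℝ) ^ 100)⁻¹ := by
  refine ⟨10 ^ 12, 4, EigenphaseEstimation.eigenphaseAlgorithm, fun d ε hd hε => ?_⟩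
  obtain ⟨hqueries, hrun, hgates⟩ := EigenphaseEstimation.costs_eigenphaseAlgorithm_le hd hε
  exact ⟨hqueries, hrun, hgates, fun _ hZ =>
    EigenphaseEstimation.prob_eigenphaseAlgorithm_le hd hε hZ⟩
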